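/- Let $k$ be a field of characteristic zero, and let $X$ be a finite group with subgroups $G,M$ such that the product map $G\times M\to X$ is bijective. Define $s\triangleright u\in G$ and $s\triangleleft u\in M$, for $s\in M$, $u\in G$, by $su=(s\triangleright u)(s\triangleleft u)$. Let $H=kM\blacktriangleright\!\!\triangleleft k(G)$ be the bicrossproduct Hopf algebra with basis $s\otimes\delta_u$ ($s\in M$, $u\in G$) and $$(s\otimes\delta_u)(t\otimes\delta_v)=\delta_{u,t\triangleright v}\,(st\otimes\delta_v),\quad 1=\sum_u e\otimes\delta_u,\quad \Delta(s\otimes\delta_u)=\sum_{xy=u}(s\otimes\delta_x)\otimes\big((s\triangleleft x)\otimes\delta_y\big),$$ $$\varepsilon(s\otimes\delta_u)=\delta_{u,e},\qquad S(s\otimes\delta_u)=(s\triangleleft u)^{-1}\otimes\delta_{(s\triangleright u)^{-1}} .$$ Put $H^+=\ker\varepsilon$. The quantum double $D(H)$ acts on $H$ by $g\triangleleft h=\sum S(h_{(1)})\,g\,h_{(2)}$ for $h\in H$ and $a\triangleright g=\sum g_{(1)}\langle g_{(2)},a\rangle$ for $a\in H^*$. It acts on $H^+$ by the same action of $H$ and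 by $g\mapsto\sum g_{(1)}\langle g_{(2)},a\rangle-\langle g,a\rangle 1$ for $a\in H^*$. Its submodules are the subspaces stable under both families of operators. The irreducible quantum tangent spaces of $H$ are the irreducible $D(H)$-submodules $L\subset H^+$. Let $kX$ be the vector space with basis $X$. Identify it with $H$ by $vt\equiv t\otimes\delta_v$ ($v\in G$, $t\in M$), so that $D(H)$ acts on $kX$ by its action on $H$, and let $\Pi:kX\to H^+$, $\Pi(vt)=t\otimes\delta_v-\varepsilon(t\otimes\delta_v)1$. Put $\|vt\|=v^{-1}t^{-1}v$, let $Z\subset X$ be the image of $\|\cdot\|:X\to X$, and let $J_z\subset kX$ be the span of $\{x\in X:\|x\|=z\}$. The group $X$ acts on $kX$ from the right by the linear maps with $$vt\,\tilde\triangleleft\,us=(\tilde s\triangleright vu)(\tilde s t\tilde s^{-1}),\qquad \tilde s=s^{-1}\triangleleft(vu)^{-1}\qquad(u,v\in G,\ s,t\in M).$$ The irreducible quantum tangent spaces $L\subset H^+$ are exactly those given by the following two cases. (a) Let $C\neq\{e\}$ be the conjugacy class in $X$ of an element $z_0\in Z$, let $\mathcal M_0\subset J_{z_0}$ be an irreducible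 (nonzero) subrepresentation of the centralizer of $z_0$ in $X$, and for each $z\in C$ choose any $\bar z\in X$ with $z=\bar z^{-1}z_0\bar z$. Then the sum $\mathcal M=\bigoplus_{z\in C}\mathcal M_0\,\tilde\triangleleft\,\bar z$ is direct, $\mathcal M$ is an irreducible $D(H)$-submodule of $kX$, $L=\Pi(\mathcal M)$ is an irreducible $D(H)$-submodule of $H^+$, and $\Pi$ restricts to an isomorphism of $D(H)$-modules $\mathcal M\cong L$. (b) Let $C=\{e\}$, the conjugacy class of $e\in Z$. Here $J_e=kG$ and the centralizer of $e$ is $X$. For every nontrivial irreducible $X$-subrepresentation $\mathcal M_0\subset kG$ (one on which $X$ does not act trivially), the space $\mathcal M=\mathcal M_0\,\tilde\triangleleft\,\bar e$ equals $\mathcal M_0$ for every choice of $\bar e\in X$, it is an irreducible $D(H)$-submodule of $kX$, $L=\Pi(\mathcal M_0)$ is an irreducible $D(H)$-submodule of $H^+$, and $\Pi$ restricts to an isomorphism of $D(H)$-modules $\mathcal M_0\cong L$. Conversely, every irreducible quantum tangent space $L\subset H^+$ is of the form $\Pi(\mathcal M)$ with $\mathcal M$ as in (a), or of the form $\Pi(\mathcal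 M_0)$ with $\mathcal M_0$ as in (b). -/

import Mathlib

open scoped TensorProduct

namespace QTangent

/-! ## Invariant and irreducible subspaces -/

section Representations

variable {k : Type*} [Field k] {V W : Type*} [AddCommGroup V] [Module k V]
  [AddCommGroup W] [Module k W] {ι : Type*}

/-- `N` is a subrepresentation for the operators `ρ i`. -/
def IsSubrep (ρ : ι → V →ₗ[k] V) (N : Submodule k V) : Prop :=
  ∀ i, ∀ v ∈ N, ρ i v ∈ N

/-- `N` is an irreducible subrepresentation: it is a nonzero subrepresentation, and the only
subrepresentations contained in it are `0` and `N`. -/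
def IsIrreducibleSubrep (ρ : ι → V →ₗ[k] V) (N : Submodule k V) : Prop :=
  N ≠ ⊥ ∧ IsSubrep ρ N ∧ ∀ N' : Submodule k V, N' ≤ N → IsSubrep ρ N' → N' = ⊥ ∨ N' = N

/-- The linear map `f` restricts to an isomorphism of representations from `N` onto `L`. -/
def RestrictsToIso (ρ : ι → V →ₗ[k] V) (σ : ι → W →ₗ[k] W) (f : V →ₗ[k] W)
    (N : Submodule k V) (L : Submodule k W) : Prop :=
  N.map f = L ∧ Set.InjOn f N ∧ ∀ i, ∀ v ∈ N, f (ρ i v) = σ i (f v)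

end Representations

/-! ## The actions of the quantum double of a Hopf algebra `H` on `H` and on `H⁺ = ker ε`

A right module of the quantum double `D(H)` is a compatible pair of a right `H`-action and a left
`H*`-action, so that `D(H)`-submodules are the subspaces stable under both. -/

section Double

variable (k : Type*) [Field k] (H : Type*) [Ring H] [HopfAlgebra k H]

/-- The augmentation ideal `H⁺ = ker ε`. -/
abbrev Aug : Submodule k H := LinearMap.ker (Coalgebra.counit (R := k) (A := H))

/-- The right quantum adjoint action `g ◁ h = ∑ S(h₁) g h₂`, as the operator `g ↦ g ◁ h`. -/
noncomputable def adR : H →ₗ[k] (H →ₗ[k] H) :=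
  TensorProduct.lift
    ((LinearMap.mul k (Module.End k H)).compl₁₂
      (LinearMap.mul k H ∘ₗ HopfAlgebra.antipode k) (LinearMap.mul k H).flip)
  ∘ₗ Coalgebra.comul

/-- The left coregular action `a ▷ h = ∑ h₁ ⟨h₂, a⟩` of `a ∈ H*`. -/
noncomputable def coreg (a : Module.Dual k H) : H →ₗ[k] H :=
  (TensorProduct.rid k H).toLinearMap ∘ₗ a.lTensor H ∘ₗ Coalgebra.comul

/-- `h ↦ a ▷ h - ⟨h, a⟩ 1`. -/
noncomputable def coregPlus (a : Module.Dual k H) : H →ₗ[k] H :=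
  coreg k H a - a.smulRight (1 : H)

/-- The projection `h ↦ h - ε(h) 1`. -/
noncomputable def projPlus : H →ₗ[k] H :=
  LinearMap.id - (Coalgebra.counit (R := k) (A := H)).smulRight (1 : H)

variable {k H}

theorem counit_adR (h g : H) :
    Coalgebra.counit (R := k) (adR k H h g) =
      Coalgebra.counit (R := k) h * Coalgebra.counit (R := k) g := by
  have hr := (Coalgebra.Repr.arbitrary k h).eq
  have h2 := congrArg (Coalgebra.counit (R := k)) (Coalgebra.sum_counit_smul
    (Coalgebra.Repr.arbitrary k h))
  rw [map_sum] at h2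
  simp only [map_smul, smul_eq_mul] at h2
  rw [adR, LinearMap.comp_apply, ← hr, ← h2, map_sum, LinearMap.sum_apply, map_sum,
    Finset.sum_mul]
  refine Finset.sum_congr rfl fun i _ => ?_
  simp
  ring

theorem counit_coreg (a : Module.Dual k H) (h : H) :
    Coalgebra.counit (R := k) (coreg k H a h) = a h := by
  have hr := (Coalgebra.Repr.arbitrary k h).eq
  have h2 := congrArg a (Coalgebra.sum_counit_smul (Coalgebra.Repr.arbitrary k h))
  rw [coreg, LinearMap.comp_apply, LinearMap.comp_apply, ← hr, ← h2]
  simp [map_sum, mul_comm]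

theorem adR_mem (h g : H) (hg : g ∈ Aug k H) : adR k H h g ∈ Aug k H := by
  rw [LinearMap.mem_ker] at hg ⊢
  rw [counit_adR, hg, mul_zero]

theorem coregPlus_mem (a : Module.Dual k H) (h : H) : coregPlus k H a h ∈ Aug k H := by
  rw [LinearMap.mem_ker]
  simp [coregPlus, counit_coreg]

theorem projPlus_mem (h : H) : projPlus k H h ∈ Aug k H := by
  rw [LinearMap.mem_ker]
  simp [projPlus]

variable (k H)

/-- The canonical action of `D(H)` on `H`: an index in `H` acts by the right quantum adjoint
action, an index in `H*` by the left coregular action. -/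
noncomputable def canonicalAction : H ⊕ Module.Dual k H → (H →ₗ[k] H) :=
  Sum.elim (fun h => adR k H h) (coreg k H)

/-- The canonical action of `D(H)` on `H⁺`: the right quantum adjoint action of `H`, and the action
`h ↦ ∑ h₁ ⟨h₂, a⟩ - ⟨h, a⟩ 1` of `a ∈ H*`. -/
noncomputable def plusAction : H ⊕ Module.Dual k H → (Aug k H →ₗ[k] Aug k H) :=
  Sum.elim (fun h => (adR k H h).restrict (adR_mem h))
    (fun a => (coregPlus k H a).restrict (fun h _ => coregPlus_mem a h))

/-- An irreducible quantum tangent space of `H`: an irreducible `D(H)`-submodule of `H⁺`. -/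
def IsIrreducibleQuantumTangentSpace (L : Submodule k (Aug k H)) : Prop :=
  IsIrreducibleSubrep (plusAction k H) L

end Double

/-! ## Group factorizations `X = GM` and the matched pair of actions -/

section Factorization

variable {X : Type*} [Group X] {G M : Subgroup X} (hGM : G.IsComplement' M)

/-- The `G`-part `v` of `x = vt`. -/
noncomputable def gPart (x : X) : G := (hGM.equiv x).1

/-- The `M`-part `t` of `x = vt`. -/
noncomputable def mPart (x : X) : M := (hGM.equiv x).2

/-- `s ▷ u`, where `su = (s ▷ u)(s ◁ u)`. -/
noncomputable def lact (s : M) (u : G) : G := gPart hGM (s * u)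

/-- `s ◁ u`, where `su = (s ▷ u)(s ◁ u)`. -/
noncomputable def ract (s : M) (u : G) : M := mPart hGM (s * u)

theorem gPart_mul_mPart (x : X) : (gPart hGM x : X) * mPart hGM x = x :=
  hGM.equiv_fst_mul_equiv_snd x

theorem parts_unique {x : X} {g : G} {m : M} (h : x = g * m) :
    gPart hGM x = g ∧ mPart hGM x = m := by
  have h1 : hGM.equiv x = (g, m) := by
    rw [← Equiv.eq_symm_apply]
    exact h
  exact ⟨congrArg Prod.fst h1, congrArg Prod.snd h1⟩

theorem lact_mul_ract (s : M) (u : G) : (lact hGM s u : X) * ract hGM s u = s * u :=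
  gPart_mul_mPart hGM _

theorem act_unique {s : M} {u g : G} {m : M} (h : (s : X) * u = g * m) :
    lact hGM s u = g ∧ ract hGM s u = m :=
  parts_unique hGM h

@[simp] theorem lact_one (s : M) : lact hGM s 1 = 1 :=
  (act_unique hGM (m := s) (by simp)).1

@[simp] theorem ract_one (s : M) : ract hGM s 1 = s :=
  (act_unique hGM (g := 1) (by simp)).2

@[simp] theorem one_lact (u : G) : lact hGM 1 u = u :=
  (act_unique hGM (m := 1) (by simp)).1

@[simp] theorem one_ract (u : G) : ract hGM 1 u = 1 :=
  (act_unique hGM (g := u) (by simp)).2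

theorem act_mul (s : M) (u v : G) :
    lact hGM s (u * v) = lact hGM s u * lact hGM (ract hGM s u) v ∧
      ract hGM s (u * v) = ract hGM (ract hGM s u) v := by
  apply act_unique
  push_cast
  rw [← mul_assoc (s : X), ← lact_mul_ract hGM s u, mul_assoc, mul_assoc, lact_mul_ract]

theorem mul_act (s t : M) (u : G) :
    lact hGM (s * t) u = lact hGM s (lact hGM t u) ∧
      ract hGM (s * t) u = ract hGM s (lact hGM t u) * ract hGM t u := by
  apply act_unique
  push_cast
  rw [← mul_assoc, lact_mul_ract, mul_assoc, mul_assoc, lact_mul_ract]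

theorem inv_act (s : M) (u : G) :
    lact hGM (ract hGM s u)⁻¹ (lact hGM s u)⁻¹ = u⁻¹ := by
  refine (act_unique hGM (m := s⁻¹) ?_).1
  push_cast
  rw [← mul_inv_rev, lact_mul_ract, mul_inv_rev]

theorem lact_eq_one_iff (s : M) (u : G) : lact hGM s u = 1 ↔ u = 1 := by
  constructor
  · intro h
    have := (mul_act hGM s⁻¹ s u).1
    rw [h] at this
    simpa using this
  · rintro rfl
    simp

end Factorization

/-! ## The bicrossproduct Hopf algebra `H = kM ▷◁ k(G)` -/

section Bicross

variable (k : Type*) [Field k] {X : Type*} [Group X] {G M : Subgroup X}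

/-- The vector space with basis `s ⊗ δ_u`, for `s ∈ M` and `u ∈ G`. -/
def Bicross (_hGM : G.IsComplement' M) : Type _ := (M × G) →₀ k

variable (hGM : G.IsComplement' M)

noncomputable instance : AddCommGroup (Bicross k hGM) :=
  inferInstanceAs (AddCommGroup ((M × G) →₀ k))

noncomputable instance : Module k (Bicross k hGM) :=
  inferInstanceAs (Module k ((M × G) →₀ k))

/-- The basis of all `s ⊗ δ_u`. -/
noncomputable def basisH : Module.Basis (M × G) k (Bicross k hGM) :=
  ⟨LinearEquiv.refl k ((M × G) →₀ k)⟩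

open Classical in
/-- The product `(s ⊗ δ_u)(t ⊗ δ_v) = δ_{u, t ▷ v} (st ⊗ δ_v)`. -/
noncomputable def mulH : Bicross k hGM →ₗ[k] Bicross k hGM →ₗ[k] Bicross k hGM :=
  (basisH k hGM).constr k fun p => (basisH k hGM).constr k fun q =>
    if p.2 = lact hGM q.1 q.2 then basisH k hGM (p.1 * q.1, q.2) else 0

open Classical in
/-- The counit `ε(s ⊗ δ_u) = δ_{u, e}`. -/
noncomputable def counitH : Bicross k hGM →ₗ[k] k :=
  (basisH k hGM).constr k fun p => if p.2 = 1 then 1 else 0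

/-- The antipode `S(s ⊗ δ_u) = (s ◁ u)⁻¹ ⊗ δ_{(s ▷ u)⁻¹}`. -/
noncomputable def antipodeH : Bicross k hGM →ₗ[k] Bicross k hGM :=
  (basisH k hGM).constr k fun p =>
    basisH k hGM ((ract hGM p.1 p.2)⁻¹, (lact hGM p.1 p.2)⁻¹)

noncomputable instance : Mul (Bicross k hGM) := ⟨fun x y => mulH k hGM x y⟩

theorem mul_def (x y : Bicross k hGM) : x * y = mulH k hGM x y := rfl

variable {k hGM} in
theorem basisH_induction {P : Bicross k hGM → Prop} (basis : ∀ p, P (basisH k hGM p))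
    (add : ∀ x y, P x → P y → P (x + y)) (smul : ∀ (c : k) x, P x → P (c • x))
    (x : Bicross k hGM) : P x := by
  have hx := (basisH k hGM).mem_span x
  induction hx using Submodule.span_induction with
  | mem x h =>
    obtain ⟨p, rfl⟩ := h
    exact basis p
  | zero => simpa using smul 0 _ (basis 1)
  | add x y _ _ hx hy => exact add x y hx hy
  | smul c x _ hx => exact smul c x hx

open Classical in
theorem mulH_basis (p q : M × G) : mulH k hGM (basisH k hGM p) (basisH k hGM q) =
    if p.2 = lact hGM q.1 q.2 then basisH k hGM (p.1 * q.1, q.2) else 0 := by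
  rw [mulH, Module.Basis.constr_basis, Module.Basis.constr_basis]

open Classical in
theorem counitH_basis (p : M × G) :
    counitH k hGM (basisH k hGM p) = if p.2 = 1 then 1 else 0 := by
  rw [counitH, Module.Basis.constr_basis]

theorem antipodeH_basis (p : M × G) : antipodeH k hGM (basisH k hGM p) =
    basisH k hGM ((ract hGM p.1 p.2)⁻¹, (lact hGM p.1 p.2)⁻¹) := by
  rw [antipodeH, Module.Basis.constr_basis]

variable [Finite X]

attribute [local instance] Fintype.ofFinite

/-- The unit `1 = ∑_u e ⊗ δ_u`. -/
noncomputable def oneH : Bicross k hGM := ∑ u : G, basisH k hGM (1, u)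

/-- The coproduct `Δ(s ⊗ δ_u) = ∑_{xy = u} (s ⊗ δ_x) ⊗ ((s ◁ x) ⊗ δ_y)`. -/
noncomputable def comulH : Bicross k hGM →ₗ[k] Bicross k hGM ⊗[k] Bicross k hGM :=
  (basisH k hGM).constr k fun p =>
    ∑ x : G, basisH k hGM (p.1, x) ⊗ₜ[k] basisH k hGM (ract hGM p.1 x, x⁻¹ * p.2)

noncomputable instance : One (Bicross k hGM) := ⟨oneH k hGM⟩

theorem one_def : (1 : Bicross k hGM) = ∑ u : G, basisH k hGM (1, u) := rfl

theorem comulH_basis (p : M × G) : comulH k hGM (basisH k hGM p) =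
    ∑ x : G, basisH k hGM (p.1, x) ⊗ₜ[k] basisH k hGM (ract hGM p.1 x, x⁻¹ * p.2) := by
  rw [comulH, Module.Basis.constr_basis]

noncomputable instance : Ring (Bicross k hGM) :=
  { (inferInstance : AddCommGroup (Bicross k hGM)), (inferInstance : Mul (Bicross k hGM)),
    (inferInstance : One (Bicross k hGM)) with
    left_distrib := fun x y z => by simp only [mul_def, map_add]
    right_distrib := fun x y z => by simp only [mul_def, map_add, LinearMap.add_apply]
    zero_mul := fun x => by simp only [mul_def, map_zero, LinearMap.zero_apply]
    mul_zero := fun x => by simp only [mul_def, map_zero]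
    mul_assoc := fun x y z => by
      simp only [mul_def]
      induction x using basisH_induction with
      | add a b ha hb => simp only [map_add, LinearMap.add_apply, ha, hb]
      | smul c a ha => simp only [map_smul, LinearMap.smul_apply, ha]
      | basis p =>
      induction y using basisH_induction with
      | add a b ha hb => simp only [map_add, LinearMap.add_apply, ha, hb]
      | smul c a ha => simp only [map_smul, LinearMap.smul_apply, ha]
      | basis q =>
      induction z using basisH_induction with
      | add a b ha hb => simp only [map_add, ha, hb]
      | smul c a ha => simp only [map_smul, ha]
      | basis r =>
      simp only [mulH_basis]
      by_cases h1 : q.2 = lact hGM r.1 r.2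
      · by_cases h2 : p.2 = lact hGM q.1 q.2
        · rw [if_pos h1, if_pos h2, mulH_basis, mulH_basis, if_pos h1, if_pos, mul_assoc]
          rw [h2, h1, (mul_act hGM _ _ _).1]
        · rw [if_pos h1, if_neg h2, mulH_basis, if_neg, map_zero, LinearMap.zero_apply]
          rw [h1] at h2
          rwa [(mul_act hGM _ _ _).1]
      · by_cases h2 : p.2 = lact hGM q.1 q.2
        · rw [if_neg h1, if_pos h2, mulH_basis, if_neg h1, map_zero]
        · rw [if_neg h1, if_neg h2, map_zero, map_zero, LinearMap.zero_apply]
    one_mul := fun x => by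
      rw [mul_def, one_def]
      induction x using basisH_induction with
      | add a b ha hb => simp only [map_add, ha, hb]
      | smul c a ha => simp only [map_smul, ha]
      | basis p =>
      rw [map_sum, LinearMap.sum_apply]
      simp only [mulH_basis]
      simp
    mul_one := fun x => by
      rw [mul_def, one_def]
      induction x using basisH_induction with
      | add a b ha hb => simp only [map_add, LinearMap.add_apply, ha, hb]
      | smul c a ha => simp only [map_smul, LinearMap.smul_apply, ha]
      | basis p =>
      rw [map_sum, Finset.sum_eq_single p.2]
      · rw [mulH_basis, if_pos (by simp)]
        simp
      · intro b _ hb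
        rw [mulH_basis, if_neg]
        simpa using hb.symm
      · simp }

noncomputable instance : Algebra k (Bicross k hGM) :=
  Algebra.ofModule (fun c x y => by simp only [mul_def, map_smul, LinearMap.smul_apply])
    (fun c x y => by simp only [mul_def, map_smul])

theorem basis_mul_basis (p q : M × G) : basisH k hGM p * basisH k hGM q = open Classical in
    if p.2 = lact hGM q.1 q.2 then basisH k hGM (p.1 * q.1, q.2) else 0 :=
  mulH_basis k hGM p q

noncomputable instance : Coalgebra k (Bicross k hGM) where
  comul := comulH k hGM
  counit := counitH k hGM
  coassoc := by
    refine (basisH k hGM).ext fun p => ?_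
    simp only [LinearMap.comp_apply, comulH_basis, map_sum, LinearMap.rTensor_tmul,
      LinearMap.lTensor_tmul, TensorProduct.sum_tmul, TensorProduct.tmul_sum,
      LinearEquiv.coe_coe, TensorProduct.assoc_tmul]
    rw [Finset.sum_comm]
    refine Finset.sum_congr rfl fun x _ => ?_
    refine (Fintype.sum_equiv (Equiv.mulLeft x) _ _ fun y => ?_).symm
    simp [(act_mul hGM p.1 x y).2, mul_assoc]
  rTensor_counit_comp_comul := by
    refine (basisH k hGM).ext fun p => ?_
    simp only [LinearMap.comp_apply, comulH_basis, map_sum, LinearMap.rTensor_tmul,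
      counitH_basis]
    rw [Finset.sum_eq_single 1]
    · simp
    · intro b _ hb
      simp [hb]
    · simp
  lTensor_counit_comp_comul := by
    refine (basisH k hGM).ext fun p => ?_
    simp only [LinearMap.comp_apply, comulH_basis, map_sum, LinearMap.lTensor_tmul,
      counitH_basis]
    rw [Finset.sum_eq_single p.2]
    · simp
    · intro b _ hb
      have : ¬ (b⁻¹ * p.2 = 1) := by
        rwa [inv_mul_eq_one]
      simp [this]
    · simp

theorem comul_basis (p : M × G) :
    Coalgebra.comul (R := k) (basisH k hGM p) =
    ∑ x : G, basisH k hGM (p.1, x) ⊗ₜ[k] basisH k hGM (ract hGM p.1 x, x⁻¹ * p.2) :=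
  comulH_basis k hGM p

theorem counit_basis (p : M × G) :
    Coalgebra.counit (R := k) (basisH k hGM p) = open Classical in if p.2 = 1 then 1 else 0 :=
  counitH_basis k hGM p

noncomputable instance : Bialgebra k (Bicross k hGM) :=
  Bialgebra.mk' k (Bicross k hGM)
    (by
      rw [one_def, map_sum]
      simp [counit_basis])
    (by
      intro x y
      induction x using basisH_induction with
      | add a b ha hb => simp only [add_mul, map_add, ha, hb]
      | smul c a ha => simp only [smul_mul_assoc, map_smul, smul_eq_mul, ha, mul_assoc]
      | basis p =>
      induction y using basisH_induction with
      | add a b ha hb => simp only [mul_add, map_add, ha, hb]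
      | smul c a ha => simp only [mul_smul_comm, map_smul, smul_eq_mul, ha, mul_left_comm]
      | basis q =>
      rw [basis_mul_basis]
      by_cases h : p.2 = lact hGM q.1 q.2
      · rw [if_pos h]
        simp only [counit_basis]
        by_cases h' : q.2 = 1
        · have h1 : p.2 = 1 := by rw [h, h', lact_one]
          simp [h', h1]
        · simp [h']
      · rw [if_neg h, map_zero]
        simp only [counit_basis]
        by_cases h' : q.2 = 1
        · rw [h', lact_one] at h
          simp [h]
        · simp [h'])
    (by
      rw [one_def, map_sum, Algebra.TensorProduct.one_def, one_def]
      simp only [comul_basis, one_ract, TensorProduct.sum_tmul, TensorProduct.tmul_sum]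
      rw [Finset.sum_comm]
      conv_rhs => rw [Finset.sum_comm]
      refine Finset.sum_congr rfl fun x _ => ?_
      exact Fintype.sum_equiv (Equiv.mulLeft x⁻¹) _ _ fun y => rfl)
    (by
      intro x y
      induction x using basisH_induction with
      | add a b ha hb => simp only [add_mul, map_add, ha, hb]
      | smul c a ha => simp only [smul_mul_assoc, map_smul, ha]
      | basis p =>
      induction y using basisH_induction with
      | add a b ha hb => simp only [mul_add, map_add, ha, hb]
      | smul c a ha => simp only [mul_smul_comm, map_smul, ha]
      | basis q =>
      rw [comul_basis, comul_basis, Finset.sum_mul_sum, Finset.sum_comm]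
      simp only [Algebra.TensorProduct.tmul_mul_tmul, basis_mul_basis]
      have key : ∀ y : G, (lact hGM q.1 y)⁻¹ * p.2 =
          lact hGM (ract hGM q.1 y) (y⁻¹ * q.2) ↔ p.2 = lact hGM q.1 q.2 := by
        intro y
        rw [inv_mul_eq_iff_eq_mul, ← (act_mul hGM q.1 y (y⁻¹ * q.2)).1, mul_inv_cancel_left]
      have inner : ∀ y : G, ∑ x : G,
          (open Classical in if x = lact hGM q.1 y then basisH k hGM (p.1 * q.1, y) else 0) ⊗ₜ[k]
          (open Classical in if x⁻¹ * p.2 = lact hGM (ract hGM q.1 y) (y⁻¹ * q.2) then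
            basisH k hGM (ract hGM p.1 x * ract hGM q.1 y, y⁻¹ * q.2) else 0) =
          open Classical in if p.2 = lact hGM q.1 q.2 then
            basisH k hGM (p.1 * q.1, y) ⊗ₜ[k] basisH k hGM (ract hGM (p.1 * q.1) y, y⁻¹ * q.2)
          else 0 := by
        intro y
        rw [Finset.sum_eq_single (lact hGM q.1 y)]
        · rw [if_pos rfl, (mul_act hGM p.1 q.1 y).2]
          by_cases h : p.2 = lact hGM q.1 q.2
          · rw [if_pos h, if_pos ((key y).2 h)]
          · rw [if_neg h, if_neg (fun h' => h ((key y).1 h')), TensorProduct.tmul_zero]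
        · intro b _ hb
          simp [hb]
        · simp
      rw [Finset.sum_congr rfl fun y _ => inner y]
      by_cases h : p.2 = lact hGM q.1 q.2
      · simp only [if_pos h, comul_basis]
      · simp [if_neg h])

/-- The bicrossproduct Hopf algebra `H = kM ▷◁ k(G)`. -/
noncomputable instance : HopfAlgebra k (Bicross k hGM) where
  antipode := antipodeH k hGM
  mul_antipode_rTensor_comul := by
    refine (basisH k hGM).ext fun p => ?_
    simp only [LinearMap.comp_apply, comul_basis, map_sum, LinearMap.rTensor_tmul,
      antipodeH_basis, LinearMap.mul'_apply, basis_mul_basis, counit_basis,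
      Algebra.linearMap_apply]
    have key : ∀ x : G, (lact hGM p.1 x)⁻¹ = lact hGM (ract hGM p.1 x) (x⁻¹ * p.2) ↔ p.2 = 1 := by
      intro x
      rw [inv_eq_iff_mul_eq_one, ← (act_mul hGM p.1 x (x⁻¹ * p.2)).1, mul_inv_cancel_left,
        lact_eq_one_iff]
    by_cases h : p.2 = 1
    · rw [Finset.sum_congr rfl fun x _ => if_pos ((key x).2 h)]
      simp only [h, if_true, map_one, one_def, inv_mul_cancel, mul_one]
      exact Fintype.sum_equiv (Equiv.inv G) _ _ fun y => rfl
    · rw [Finset.sum_eq_zero fun x _ => if_neg fun h' => h ((key x).1 h')]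
      simp [h]
  mul_antipode_lTensor_comul := by
    refine (basisH k hGM).ext fun p => ?_
    simp only [LinearMap.comp_apply, comul_basis, map_sum, LinearMap.lTensor_tmul,
      antipodeH_basis, LinearMap.mul'_apply, basis_mul_basis, counit_basis,
      Algebra.linearMap_apply]
    have key : ∀ x : G, x = lact hGM (ract hGM (ract hGM p.1 x) (x⁻¹ * p.2))⁻¹
        (lact hGM (ract hGM p.1 x) (x⁻¹ * p.2))⁻¹ ↔ p.2 = 1 := by
      intro x
      rw [inv_act, mul_inv_rev, inv_inv, eq_comm, mul_eq_right, inv_eq_one]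
    by_cases h : p.2 = 1
    · rw [Finset.sum_congr rfl fun x _ => if_pos ((key x).2 h)]
      simp only [h, if_true, map_one, one_def, mul_one, ← (act_mul hGM _ _ _).2, mul_inv_cancel,
        ract_one]
      have hb : Function.Bijective (fun x : G => lact hGM p.1 x) := by
        rw [← Finite.injective_iff_bijective]
        intro x y hxy
        have := congrArg (lact hGM p.1⁻¹) hxy
        simpa [← (mul_act hGM _ _ _).1] using this
      refine Fintype.sum_bijective _ hb _ _ fun x => ?_
      have := (act_mul hGM p.1 x x⁻¹).1
      rw [mul_inv_cancel, lact_one, eq_comm, ← eq_inv_iff_mul_eq_one] at this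
      rw [this]
    · rw [Finset.sum_eq_zero fun x _ => if_neg fun h' => h ((key x).1 h')]
      simp [h]

end Bicross

/-! ## The space `kX` as an `X`-crossed module and as a `D(H)`-module -/

section Crossed

variable (k : Type*) [Field k] {X : Type*} [Group X] {G M : Subgroup X}
  (hGM : G.IsComplement' M)

/-- `‖vt‖ = v⁻¹ t⁻¹ v` for `v ∈ G` and `t ∈ M`. -/
noncomputable def xNorm (x : X) : X :=
  (gPart hGM x : X)⁻¹ * (mPart hGM x : X)⁻¹ * gPart hGM x

/-- The right action of `us ∈ X` on the set `X`: for `s' = s⁻¹ ◁ (vu)⁻¹`, the element `vt` is sent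
to `(s' ▷ vu) (s' t s'⁻¹)`. -/
noncomputable def xAct (x y : X) : X :=
  let v := gPart hGM x
  let t := mPart hGM x
  let u := gPart hGM y
  let s := mPart hGM y
  let s' := ract hGM s⁻¹ (v * u)⁻¹
  lact hGM s' (v * u) * (s' * t * s'⁻¹ : M)

/-- The linear operator by which `y ∈ X` acts on `kX` from the right. -/
noncomputable def xOp (y : X) : (X →₀ k) →ₗ[k] (X →₀ k) :=
  Finsupp.lmapDomain k k fun x => xAct hGM x y

/-- The image `Z` of `‖·‖`. -/
def imageZ : Set X := Set.range (xNorm hGM)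

/-- `J_z`, the span in `kX` of the elements `x` of `X` with `‖x‖ = z`. -/
def spaceJ (z : X) : Submodule k (X →₀ k) := Finsupp.supported k k (xNorm hGM ⁻¹' {z})

/-- The right action on `kX` of the centralizer of `z` in `X`. -/
noncomputable def centralizerOp (z : X) :
    Subgroup.centralizer ({z} : Set X) → (X →₀ k) →ₗ[k] (X →₀ k) :=
  fun x => xOp k hGM x

/-- `bar` chooses for each `z` in the conjugacy class of `z₀` an element `z̄` with
`z = z̄⁻¹ z₀ z̄`. -/
def IsConjChoice (z₀ : X) (bar : conjugatesOf z₀ → X) : Prop :=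
  ∀ z : conjugatesOf z₀, (z : X) = (bar z)⁻¹ * z₀ * bar z

/-- The translate of `M₀` by `z̄`. -/
noncomputable def translate (z₀ : X) (bar : conjugatesOf z₀ → X) (M₀ : Submodule k (X →₀ k))
    (z : conjugatesOf z₀) : Submodule k (X →₀ k) :=
  M₀.map (xOp k hGM (bar z))

/-- The sum of the translates of `M₀` over the conjugacy class of `z₀`. -/
noncomputable def sumTranslates (z₀ : X) (bar : conjugatesOf z₀ → X)
    (M₀ : Submodule k (X →₀ k)) : Submodule k (X →₀ k) :=
  ⨆ z : conjugatesOf z₀, translate k hGM z₀ bar M₀ z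

/-- `X` acts nontrivially on the subspace `N` of `kX`. -/
def IsNontrivialRep (N : Submodule k (X →₀ k)) : Prop :=
  ∃ x : X, ∃ v ∈ N, xOp k hGM x v ≠ v

/-- The identification of `kX` with `H` by `vt = t ⊗ δ_v`. -/
noncomputable def ident : (X →₀ k) ≃ₗ[k] Bicross k hGM :=
  Finsupp.basisSingleOne.equiv (basisH k hGM) (hGM.equiv.trans (Equiv.prodComm _ _))

theorem ident_single (v : G) (t : M) :
    ident k hGM (Finsupp.single ((v : X) * t) 1) = basisH k hGM (t, v) := by
  have h1 := (parts_unique hGM (rfl : (v : X) * t = v * t)).1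
  have h2 := (parts_unique hGM (rfl : (v : X) * t = v * t)).2
  have h : ident k hGM (Finsupp.single ((v : X) * t) 1) =
      basisH k hGM (mPart hGM ((v : X) * t), gPart hGM ((v : X) * t)) := by
    have h3 := Module.Basis.equiv_apply (Finsupp.basisSingleOne (R := k)) ((v : X) * t)
      (basisH k hGM) (hGM.equiv.trans (Equiv.prodComm _ _))
    simp only [Finsupp.coe_basisSingleOne] at h3
    exact h3
  rw [h, h1, h2]

variable [Finite X]

/-- The action of `D(H)` on `kX`: its canonical action on `H`, carried over to `kX`. -/
noncomputable def doubleAction (i : Bicross k hGM ⊕ Module.Dual k (Bicross k hGM)) :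
    (X →₀ k) →ₗ[k] (X →₀ k) :=
  (ident k hGM).symm.toLinearMap ∘ₗ canonicalAction k (Bicross k hGM) i ∘ₗ
    (ident k hGM).toLinearMap

/-- The map `Π : kX → H⁺`, `vt ↦ t ⊗ δ_v - ε(t ⊗ δ_v) 1`. -/
noncomputable def mapPi : (X →₀ k) →ₗ[k] Aug k (Bicross k hGM) :=
  (projPlus k (Bicross k hGM)).codRestrict _ projPlus_mem ∘ₗ (ident k hGM).toLinearMap

end Crossed
end QTangent

open QTangent

namespace QTangent

/-! ### Transport of irreducibility along intertwining maps -/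

section Representations

variable {k : Type*} [Field k] {V W : Type*} [AddCommGroup V] [Module k V]
  [AddCommGroup W] [Module k W] {ι : Type*} {ρ : ι → V →ₗ[k] V} {σ : ι → W →ₗ[k] W}
  {f : V →ₗ[k] W} {N : Submodule k V}

/-! The argument rests on a dictionary: a subspace of `kX` is `D(H)`-stable exactly when it is
stable under `X` and graded by `‖·‖`, i.e. closed under the projections `normProj z` onto the `J_z`.
On a fixed `J_z`, a basis element of `H` acts as zero or as one element of `M`, and a functional
acts as a linear combination of elements of `G`, with coefficients depending only on `z`
(`doubleAction_inl_single`, `doubleAction_inr_single`). Conversely, the projections, and the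
elements of `G` and `M` on each `J_z`, are themselves realised by `D(H)`
(`normProj_eq_doubleAction`, `isSubrep_xOp_of`).

Since `X` permutes the `J_z` by conjugating `z`, irreducible graded `X`-modules are classified as in
Clifford–Mackey theory. Such a module lives on one conjugacy class, its `z₀`-component is an
irreducible module of the centralizer of `z₀`, and it is the sum of the translates of that component
(`isIrreducibleSubrep_sumTranslates`, `isIrreducibleSubrep_inf_spaceJ`, `eq_sumTranslates`).

To pass to `H⁺`, note that `Π` intertwines the actions and has kernel the line of `1 ∈ H`, which is
the sum of the elements of `G`. The functional `sumG` has a `D(H)`-stable kernel and takes the value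
`|G| ≠ 0` on that line, so `Π` maps `ker sumG` isomorphically onto `H⁺`. Components with `z ≠ e` lie
in this kernel automatically; inside `J_e = kG`, an irreducible module lies in it exactly when it is
nontrivial, because `G` is a single `X`-orbit. -/

theorem IsSubrep.map (hf : ∀ i v, f (ρ i v) = σ i (f v)) (hN : IsSubrep ρ N) :
    IsSubrep σ (N.map f) := by
  rintro i _ ⟨v, hv, rfl⟩
  exact ⟨ρ i v, hN i v hv, hf i v⟩

theorem IsSubrep.comap {L : Submodule k W} (hf : ∀ i v, f (ρ i v) = σ i (f v))
    (hL : IsSubrep σ L) : IsSubrep ρ (L.comap f) := by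
  intro i v hv
  rw [Submodule.mem_comap, hf]
  exact hL i _ hv

theorem IsSubrep.inf {N' : Submodule k V} (hN : IsSubrep ρ N) (hN' : IsSubrep ρ N') :
    IsSubrep ρ (N ⊓ N') :=
  fun i v hv => ⟨hN i v hv.1, hN' i v hv.2⟩

theorem map_injOn {N' : Submodule k V} (hinj : Set.InjOn f N) (h' : N' ≤ N)
    (h : N.map f ≤ N'.map f) : N' = N := by
  refine le_antisymm h' fun v hv => ?_
  obtain ⟨w, hw, hwv⟩ := h ⟨v, hv, rfl⟩
  rwa [← hinj (h' hw) hv hwv]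

theorem isIrreducibleSubrep_map (hf : ∀ i v, f (ρ i v) = σ i (f v)) (hinj : Set.InjOn f N)
    (hN : IsIrreducibleSubrep ρ N) : IsIrreducibleSubrep σ (N.map f) := by
  obtain ⟨hne, hsub, hirr⟩ := hN
  refine ⟨fun h => hne ?_, hsub.map hf, fun L hL hLs => ?_⟩
  · exact (map_injOn hinj bot_le (by rw [h]; exact bot_le)).symm
  -- Intertwining is global but injectivity holds only on `N`, so preimages are cut down to `N`.
  · have hm : (N ⊓ L.comap f).map f = L := by
      refine le_antisymm (by rintro _ ⟨v, hv, rfl⟩; exact hv.2) fun w hw => ?_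
      obtain ⟨v, hv, rfl⟩ := hL hw
      exact ⟨v, ⟨hv, hw⟩, rfl⟩
    rcases hirr _ inf_le_left (hsub.inf (hLs.comap hf)) with h | h
    · left; rw [← hm, h, Submodule.map_bot]
    · right; rw [← hm, h]

theorem isIrreducibleSubrep_of_map (hf : ∀ i v, f (ρ i v) = σ i (f v)) (hinj : Set.InjOn f N)
    (hsub : IsSubrep ρ N) (hN : IsIrreducibleSubrep σ (N.map f)) : IsIrreducibleSubrep ρ N := by
  refine ⟨fun h => hN.1 (by rw [h, Submodule.map_bot]), hsub, fun N' h' hs' => ?_⟩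
  rcases hN.2.2 (N'.map f) (Submodule.map_mono h') (hs'.map hf) with h | h
  · left
    exact (map_injOn (hinj.mono h') bot_le (by rw [h]; exact bot_le)).symm
  · right
    exact map_injOn hinj h' h.ge

end Representations

/-! ### `H⁺` as the quotient of `H` by the line of `1` -/

section Double

variable {k : Type*} [Field k] {H : Type*} [Ring H] [HopfAlgebra k H]

theorem adR_one (h : H) : adR k H h 1 = Coalgebra.counit (R := k) h • (1 : H) := by
  have hr := (Coalgebra.Repr.arbitrary k h).eq
  have h2 := LinearMap.congr_fun (HopfAlgebra.mul_antipode_rTensor_comul (R := k) (A := H)) h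
  rw [LinearMap.comp_apply, LinearMap.comp_apply, LinearMap.comp_apply, Algebra.linearMap_apply,
    Algebra.algebraMap_eq_smul_one] at h2
  rw [← h2, adR, LinearMap.comp_apply, ← hr]
  simp

theorem coreg_one (a : Module.Dual k H) : coreg k H a 1 = a 1 • (1 : H) := by
  rw [coreg, LinearMap.comp_apply, LinearMap.comp_apply, Bialgebra.comul_one,
    Algebra.TensorProduct.one_def]
  simp

/-- By `adR_one` and `coreg_one` the line of `1` is a submodule, and the action on `H⁺` is the one
induced on the quotient by this line, identified with `H⁺` through `projPlus`. -/
theorem projPlus_canonicalAction (i : H ⊕ Module.Dual k H) (h : H) :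
    (projPlus k H).codRestrict _ projPlus_mem (canonicalAction k H i h) =
      plusAction k H i ((projPlus k H).codRestrict _ projPlus_mem h) := by
  apply Subtype.ext
  rcases i with g | a
  · simp [canonicalAction, plusAction, projPlus, counit_adR, adR_one, smul_smul, mul_comm]
  · simp [canonicalAction, plusAction, projPlus, counit_coreg, coreg_one, coregPlus, sub_smul, mul_smul]

end Double

/-! ### The right action of `X` on the set `X` and its compatibility with `‖·‖` -/

section Factorization

variable {X : Type*} [Group X] {G M : Subgroup X} (hGM : G.IsComplement' M)

theorem gPart_mul (v : G) (t : M) : gPart hGM ((v : X) * t) = v := (parts_unique hGM rfl).1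

theorem mPart_mul (v : G) (t : M) : mPart hGM ((v : X) * t) = t := (parts_unique hGM rfl).2

theorem xNorm_mul (v : G) (t : M) : xNorm hGM ((v : X) * t) = (v : X)⁻¹ * (t : X)⁻¹ * v := by
  rw [xNorm, gPart_mul, mPart_mul]

/-- Since `‖vt‖⁻¹ = v⁻¹ t v`, its factorization comes from `tv = (t ▷ v)(t ◁ v)`. This is what lets
the coefficients of the `D(H)`-action be read off from the norm alone. -/
theorem parts_xNorm_inv (v : G) (t : M) :
    gPart hGM (xNorm hGM ((v : X) * t))⁻¹ = v⁻¹ * lact hGM t v ∧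
      mPart hGM (xNorm hGM ((v : X) * t))⁻¹ = ract hGM t v := by
  apply parts_unique
  rw [xNorm_mul]
  rw [Subgroup.coe_mul, mul_assoc ((v⁻¹ : G) : X), lact_mul_ract]
  simp [mul_assoc]

theorem xNorm_eq_one_iff (x : X) : xNorm hGM x = 1 ↔ x ∈ G := by
  have hx := gPart_mul_mPart hGM x
  constructor
  · intro h
    rw [xNorm, mul_assoc, inv_mul_eq_one, eq_comm, mul_eq_right, inv_eq_one] at h
    rw [← hx, h, mul_one]
    exact (gPart hGM x).2
  · intro h
    have h1 := parts_unique hGM (x := x) (g := ⟨x, h⟩) (m := 1) (by simp)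
    rw [xNorm, h1.2]
    simp

/-- A coset `Mv` contains only one element of `G`, and once `v` is known the norm `v⁻¹ t⁻¹ v`
recovers `t`. Identities for the action can thus be checked on cosets and norms. -/
theorem eq_of_gPart_of_xNorm {x y : X} {m : M} (h : (gPart hGM x : X) = m * gPart hGM y)
    (hn : xNorm hGM x = xNorm hGM y) : x = y := by
  have h1 := act_unique hGM (s := m) (u := gPart hGM y) (g := gPart hGM x) (m := 1)
    (by rw [← h]; simp)
  have hm : m = 1 := by
    have h2 := act_mul hGM m (gPart hGM y) (gPart hGM y)⁻¹
    rw [mul_inv_cancel, ract_one, h1.2, one_ract] at h2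
    exact h2.2
  have hg : gPart hGM x = gPart hGM y := Subtype.ext (by rw [h, hm]; simp)
  rw [xNorm, xNorm, hg, mul_left_inj, mul_right_inj, inv_inj] at hn
  rw [← gPart_mul_mPart hGM x, ← gPart_mul_mPart hGM y, hg, hn]

/-- As `s̃ ◁ vu = s⁻¹`, one has `s̃ ▷ vu = s̃ v u s`: up to a left factor from `M`, the action is
right multiplication on the `G`-part. -/
theorem lact_xAct (x y : X) : ∃ m : M,
    xAct hGM x y = lact hGM m (gPart hGM x * gPart hGM y) * (m * mPart hGM x * m⁻¹ : M) ∧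
      (lact hGM m (gPart hGM x * gPart hGM y) : X) = m * gPart hGM x * y := by
  refine ⟨_, rfl, ?_⟩
  have h1 := lact_mul_ract hGM (ract hGM (mPart hGM y)⁻¹ (gPart hGM x * gPart hGM y)⁻¹)
    (gPart hGM x * gPart hGM y)
  rw [← (act_mul hGM _ _ _).2, inv_mul_cancel, ract_one, Subgroup.coe_inv, mul_inv_eq_iff_eq_mul]
    at h1
  rw [h1, Subgroup.coe_mul, mul_assoc, mul_assoc, gPart_mul_mPart, mul_assoc]

theorem gPart_xAct (x y : X) : ∃ m : M, (gPart hGM (xAct hGM x y) : X) = m * gPart hGM x * y := by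
  obtain ⟨m, h, hm⟩ := lact_xAct hGM x y
  exact ⟨m, by rw [h, gPart_mul, hm]⟩

theorem xNorm_xAct (x y : X) : xNorm hGM (xAct hGM x y) = y⁻¹ * xNorm hGM x * y := by
  obtain ⟨m, h, hm⟩ := lact_xAct hGM x y
  rw [h, xNorm_mul, hm, xNorm]
  push_cast
  group

theorem xAct_one (x : X) : xAct hGM x 1 = x := by
  obtain ⟨m, hm⟩ := gPart_xAct hGM x 1
  exact eq_of_gPart_of_xNorm hGM (m := m) (by rw [hm, mul_one]) (by rw [xNorm_xAct]; simp)

/-- Both sides have `G`-part in the coset `M v y z`, where `v` is the `G`-part of `x`, and the same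
conjugate of `‖x‖` as norm. -/
theorem xAct_mul (x y z : X) : xAct hGM x (y * z) = xAct hGM (xAct hGM x y) z := by
  obtain ⟨m, hm⟩ := gPart_xAct hGM x (y * z)
  obtain ⟨m', hm'⟩ := gPart_xAct hGM x y
  obtain ⟨n, hn⟩ := gPart_xAct hGM (xAct hGM x y) z
  refine eq_of_gPart_of_xNorm hGM (m := m * m'⁻¹ * n⁻¹) ?_ ?_
  · rw [hm, hn, hm']
    push_cast
    group
  · simp only [xNorm_xAct]
    group

theorem xAct_mem (x : X) {u : X} (hu : u ∈ G) :
    xAct hGM x u = gPart hGM x * u * mPart hGM x := by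
  have h := parts_unique hGM (x := u) (g := ⟨u, hu⟩) (m := 1) (by simp)
  rw [xAct, h.1, h.2]
  simp

theorem xAct_of_mem_right (x : X) (s : M) :
    xAct hGM x s = lact hGM (ract hGM s⁻¹ (gPart hGM x)⁻¹) (gPart hGM x) *
      (ract hGM s⁻¹ (gPart hGM x)⁻¹ * mPart hGM x * (ract hGM s⁻¹ (gPart hGM x)⁻¹)⁻¹ : M) := by
  have h := parts_unique hGM (x := s) (g := 1) (m := s) (by simp)
  rw [xAct, h.1, h.2]
  simp

theorem ract_inv_ract (s : M) (u : G) : ract hGM (ract hGM s u) u⁻¹ = s := by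
  rw [← (act_mul hGM _ _ _).2, mul_inv_cancel, ract_one]

theorem lact_inv_lact (s : M) (u : G) : lact hGM s (lact hGM s⁻¹ u) = u := by
  rw [← (mul_act hGM _ _ _).1, mul_inv_cancel, one_lact]

end Factorization

/-! ### The actions of `H` and `H*` on basis vectors -/

section Bicross

variable (k : Type*) [Field k] {X : Type*} [Group X] {G M : Subgroup X}
  (hGM : G.IsComplement' M) [Finite X]

attribute [local instance] Fintype.ofFinite

theorem adR_basis (s : M) (u : G) (t : M) (v : G) :
    adR k (Bicross k hGM) (basisH k hGM (s, u)) (basisH k hGM (t, v)) = open Classical in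
      if lact hGM s u = (lact hGM t v)⁻¹ * v then
        basisH k hGM (ract hGM s⁻¹ (lact hGM t v)⁻¹ * t * (ract hGM s⁻¹ (lact hGM t v)⁻¹)⁻¹,
          lact hGM (ract hGM s⁻¹ (lact hGM t v)⁻¹) v) else 0 := by
  -- Only one term of the coproduct sum can survive, the one with `s ▷ x = (t ▷ v)⁻¹`; what is left
  -- is a condition on `u`.
  have key : ∀ x : G, basisH k hGM ((ract hGM s x)⁻¹, (lact hGM s x)⁻¹) *
      (basisH k hGM (t, v) * basisH k hGM (ract hGM s x, x⁻¹ * u)) = open Classical in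
      if x = lact hGM s⁻¹ (lact hGM t v)⁻¹ ∧ lact hGM s u = (lact hGM t v)⁻¹ * v then
        basisH k hGM (ract hGM s⁻¹ (lact hGM t v)⁻¹ * t * (ract hGM s⁻¹ (lact hGM t v)⁻¹)⁻¹,
          lact hGM (ract hGM s⁻¹ (lact hGM t v)⁻¹) v) else 0 := by
    intro x
    by_cases hx : x = lact hGM s⁻¹ (lact hGM t v)⁻¹
    · have hsx : lact hGM s x = (lact hGM t v)⁻¹ := by rw [hx, lact_inv_lact]
      have hr : ract hGM s⁻¹ (lact hGM t v)⁻¹ = (ract hGM s x)⁻¹ := by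
        have h := (mul_act hGM s⁻¹ s x).2
        rw [inv_mul_cancel, one_ract, hsx] at h
        exact eq_inv_of_mul_eq_one_left h.symm
      have hu : lact hGM s u = (lact hGM t v)⁻¹ * lact hGM (ract hGM s x) (x⁻¹ * u) := by
        rw [← hsx, ← (act_mul hGM _ _ _).1, mul_inv_cancel_left]
      by_cases h : v = lact hGM (ract hGM s x) (x⁻¹ * u)
      · rw [if_pos ⟨hx, by rw [hu, ← h]⟩, basis_mul_basis, if_pos h, basis_mul_basis, if_pos, hr]
        · rw [inv_inv, ← mul_assoc, h, ← (mul_act hGM _ _ _).1, inv_mul_cancel, one_lact]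
        · rw [hsx, inv_inv, (mul_act hGM _ _ _).1, ← h]
      · rw [if_neg fun h' => h ?_, basis_mul_basis, if_neg h, mul_zero]
        have := h'.2
        rw [hu, mul_right_inj] at this
        exact this.symm
    · rw [if_neg fun h => hx h.1, basis_mul_basis]
      by_cases h : v = lact hGM (ract hGM s x) (x⁻¹ * u)
      · rw [if_pos h, basis_mul_basis, if_neg fun h' => hx ?_]
        rw [(mul_act hGM _ _ _).1, ← h, inv_eq_iff_eq_inv] at h'
        rw [← h', ← (mul_act hGM _ _ _).1, inv_mul_cancel, one_lact]
      · rw [if_neg h, mul_zero]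
  have hS : ∀ p, HopfAlgebra.antipode k (basisH k hGM p) = basisH k hGM
      ((ract hGM p.1 p.2)⁻¹, (lact hGM p.1 p.2)⁻¹) := antipodeH_basis k hGM
  rw [adR, LinearMap.comp_apply, comul_basis, map_sum, LinearMap.sum_apply]
  simp only [TensorProduct.lift.tmul, LinearMap.compl₁₂_apply, LinearMap.comp_apply, hS,
    LinearMap.mul_apply', LinearMap.flip_apply, Module.End.mul_apply]
  rw [Finset.sum_congr rfl fun x _ => key x]
  by_cases h : lact hGM s u = (lact hGM t v)⁻¹ * v
  · rw [if_pos h, Finset.sum_eq_single (lact hGM s⁻¹ (lact hGM t v)⁻¹)]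
    · rw [if_pos ⟨rfl, h⟩]
    · exact fun x _ hx => if_neg fun h' => hx h'.1
    · simp
  · rw [if_neg h]
    exact Finset.sum_eq_zero fun x _ => if_neg fun h' => h h'.2

theorem coreg_basis (a : Module.Dual k (Bicross k hGM)) (t : M) (v : G) :
    coreg k (Bicross k hGM) a (basisH k hGM (t, v)) =
      ∑ w : G, a (basisH k hGM (ract hGM t (v * w⁻¹), w)) • basisH k hGM (t, v * w⁻¹) := by
  rw [coreg, LinearMap.comp_apply, LinearMap.comp_apply, comul_basis, map_sum, map_sum]
  -- The substitution is `w = x⁻¹ v`.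
  refine Fintype.sum_equiv ((Equiv.inv G).trans (Equiv.mulRight v)) _ _ fun x => ?_
  simp

end Bicross
-- `D(H)`-submodules of `kX` are the graded `X`-submodules
section Crossed

variable (k : Type*) [Field k] {X : Type*} [Group X] {G M : Subgroup X}
  (hGM : G.IsComplement' M)

theorem xOp_single (x y : X) :
    xOp k hGM y (Finsupp.single x 1) = Finsupp.single (xAct hGM x y) 1 := by
  simp [xOp]

theorem xOp_one (f : X →₀ k) : xOp k hGM 1 f = f := by
  rw [← LinearMap.id_apply (R := k) f, ← LinearMap.comp_apply]
  congr 1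
  refine Finsupp.lhom_ext' fun x => LinearMap.ext_ring ?_
  simp [xOp_single, xAct_one]

theorem xOp_mul (y z : X) (f : X →₀ k) : xOp k hGM (y * z) f = xOp k hGM z (xOp k hGM y f) := by
  rw [← LinearMap.comp_apply]
  congr 1
  refine Finsupp.lhom_ext' fun x => LinearMap.ext_ring ?_
  simp [xOp_single, xAct_mul]

theorem xOp_xOp_inv (y : X) (f : X →₀ k) : xOp k hGM y (xOp k hGM y⁻¹ f) = f := by
  rw [← xOp_mul, inv_mul_cancel, xOp_one]

open Classical in
/-- The projection of `kX` onto `J_z` along the other `J_w`. -/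
noncomputable def normProj (z : X) : (X →₀ k) →ₗ[k] (X →₀ k) :=
  Finsupp.linearCombination k fun x => if xNorm hGM x = z then Finsupp.single x 1 else 0

open Classical in
theorem normProj_single (z x : X) : normProj k hGM z (Finsupp.single x 1) =
    if xNorm hGM x = z then Finsupp.single x 1 else 0 := by
  rw [normProj, Finsupp.linearCombination_single, one_smul]

theorem single_mem_spaceJ (x : X) : Finsupp.single x 1 ∈ spaceJ k hGM (xNorm hGM x) :=
  Finsupp.single_mem_supported k 1 rfl

theorem normProj_mem (z : X) (f : X →₀ k) : normProj k hGM z f ∈ spaceJ k hGM z := by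
  classical
  rw [normProj, Finsupp.linearCombination_apply]
  refine Submodule.sum_mem _ fun x _ => Submodule.smul_mem _ _ ?_
  split_ifs with h
  · rw [← h]
    exact single_mem_spaceJ k hGM x
  · exact zero_mem _

variable {k hGM} in
-- Reduces a comparison of operators on `J_z` to basis vectors of norm `z`, where norm-dependent
-- coefficients become constants.
theorem eq_of_mem_spaceJ {W : Type*} [AddCommGroup W] [Module k W] {S T : (X →₀ k) →ₗ[k] W}
    {z : X} (h : ∀ x, xNorm hGM x = z → S (Finsupp.single x 1) = T (Finsupp.single x 1))
    {f : X →₀ k} (hf : f ∈ spaceJ k hGM z) : S f = T f := by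
  rw [spaceJ, Finsupp.supported_eq_span_single] at hf
  refine LinearMap.eqOn_span ?_ hf
  rintro _ ⟨x, hx, rfl⟩
  exact h x hx

theorem normProj_of_mem {z : X} {f : X →₀ k} (hf : f ∈ spaceJ k hGM z) :
    normProj k hGM z f = f :=
  eq_of_mem_spaceJ (T := LinearMap.id) (fun x hx => by simp [normProj_single, hx]) hf

theorem normProj_of_mem_ne {z w : X} (hzw : w ≠ z) {f : X →₀ k} (hf : f ∈ spaceJ k hGM w) :
    normProj k hGM z f = 0 :=
  eq_of_mem_spaceJ (T := 0) (fun x hx => by simp [normProj_single, hx, hzw]) hf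

theorem xOp_mem_spaceJ {z : X} (y : X) {f : X →₀ k} (hf : f ∈ spaceJ k hGM z) :
    xOp k hGM y f ∈ spaceJ k hGM (y⁻¹ * z * y) := by
  rw [← normProj_of_mem k hGM hf]
  have : xOp k hGM y (normProj k hGM z f) =
      normProj k hGM (y⁻¹ * z * y) (xOp k hGM y (normProj k hGM z f)) := by
    refine eq_of_mem_spaceJ (T := normProj k hGM (y⁻¹ * z * y) ∘ₗ xOp k hGM y) (fun x hx => ?_)
      (normProj_mem k hGM z f)
    simp [xOp_single, normProj_single, xNorm_xAct, hx]
  rw [this]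
  exact normProj_mem k hGM _ _

open Classical in
variable {k hGM} in
theorem coord_basisH (p q : M × G) :
    (basisH k hGM).coord p (basisH k hGM q) = if q = p then 1 else 0 := by
  rw [Module.Basis.coord_apply, Module.Basis.repr_self, Finsupp.single_apply]

variable [Finite X]

attribute [local instance] Fintype.ofFinite

theorem sum_normProj (f : X →₀ k) : ∑ z : X, normProj k hGM z f = f := by
  have : ∑ z : X, normProj k hGM z = LinearMap.id := by
    refine Finsupp.lhom_ext' fun x => LinearMap.ext_ring ?_
    rw [LinearMap.comp_apply, LinearMap.sum_apply, Finset.sum_eq_single (xNorm hGM x)]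
    · simp [normProj_single]
    · intro z _ hz
      simp [normProj_single, hz.symm]
    · simp
  rw [← LinearMap.sum_apply, this, LinearMap.id_apply]

open Classical in
-- The condition and the acting element of `M` involve `x` only through `‖x‖`, so on each `J_z` this
-- operator is zero or the action of a single group element.
theorem doubleAction_inl_single (s : M) (u : G) (x : X) :
    doubleAction k hGM (Sum.inl (basisH k hGM (s, u))) (Finsupp.single x 1) =
      if lact hGM s u = (gPart hGM (xNorm hGM x)⁻¹)⁻¹ then
        Finsupp.single (xAct hGM x (ract hGM s⁻¹ (gPart hGM (xNorm hGM x)⁻¹)⁻¹)⁻¹) 1 else 0 := by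
  obtain ⟨v, t, rfl⟩ : ∃ (v : G) (t : M), x = v * t := ⟨_, _, (gPart_mul_mPart hGM x).symm⟩
  rw [(parts_xNorm_inv hGM v t).1, doubleAction, LinearMap.comp_apply, LinearMap.comp_apply,
    LinearEquiv.coe_coe, LinearEquiv.coe_coe, ident_single, canonicalAction, Sum.elim_inl,
    adR_basis, LinearEquiv.symm_apply_eq, mul_inv_rev, inv_inv]
  by_cases h : lact hGM s u = (lact hGM t v)⁻¹ * v
  · rw [if_pos h, if_pos h, ← Subgroup.coe_inv, xAct_of_mem_right, ident_single, gPart_mul,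
      mPart_mul, inv_inv, ← (act_mul hGM _ _ _).2, mul_inv_cancel_right]
  · rw [if_neg h, if_neg h, map_zero]

/-- The coefficients depend on `x` only through `‖x‖`, so on each `J_z` a functional acts as a fixed
combination of elements of `G`. -/
theorem doubleAction_inr_single (a : Module.Dual k (Bicross k hGM)) (x : X) :
    doubleAction k hGM (Sum.inr a) (Finsupp.single x 1) =
      ∑ w : G, a (basisH k hGM (mPart hGM (w * xNorm hGM x * (w : X)⁻¹)⁻¹, w)) •
        Finsupp.single (xAct hGM x (w : X)⁻¹) 1 := by
  have hw : ∀ w : G, w * xNorm hGM x * (w : X)⁻¹ = xNorm hGM (xAct hGM x (w : X)⁻¹) := fun w => by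
    rw [xNorm_xAct, inv_inv]
  simp only [hw]
  obtain ⟨v, t, rfl⟩ : ∃ (v : G) (t : M), x = v * t := ⟨_, _, (gPart_mul_mPart hGM x).symm⟩
  have hx : ∀ w : G, xAct hGM (v * t) (w : X)⁻¹ = (v * w⁻¹ : G) * t := fun w => by
    rw [xAct_mem hGM _ (inv_mem w.2), gPart_mul, mPart_mul]
    simp
  rw [doubleAction, LinearMap.comp_apply, LinearMap.comp_apply, LinearEquiv.coe_coe,
    LinearEquiv.coe_coe, ident_single, canonicalAction, Sum.elim_inr, coreg_basis,
    LinearEquiv.symm_apply_eq, map_sum]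
  refine Finset.sum_congr rfl fun w _ => ?_
  rw [hx, map_smul, ident_single, (parts_xNorm_inv hGM _ _).2]

variable {k hGM} {N : Submodule k (X →₀ k)}

theorem mem_of_forall_normProj (h : ∀ z, ∀ f ∈ N, normProj k hGM z f ∈ N)
    {T : (X →₀ k) →ₗ[k] (X →₀ k)} (hT : ∀ z, ∀ f ∈ N, f ∈ spaceJ k hGM z → T f ∈ N)
    {f : X →₀ k} (hf : f ∈ N) : T f ∈ N := by
  rw [← sum_normProj k hGM f, map_sum]
  exact sum_mem fun z _ => hT z _ (h z f hf) (normProj_mem k hGM z f)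

theorem doubleAction_inl_mem (h : ∀ z, ∀ f ∈ N, normProj k hGM z f ∈ N)
    (hX : IsSubrep (xOp k hGM) N) (b : Bicross k hGM) {f : X →₀ k} (hf : f ∈ N) :
    doubleAction k hGM (Sum.inl b) f ∈ N := by
  induction b using basisH_induction with
  | add b c hb hc =>
    have : doubleAction k hGM (Sum.inl (b + c)) f =
        doubleAction k hGM (Sum.inl b) f + doubleAction k hGM (Sum.inl c) f := by
      simp [doubleAction, canonicalAction]
    rw [this]
    exact add_mem hb hc
  | smul c b hb =>
    have : doubleAction k hGM (Sum.inl (c • b)) f = c • doubleAction k hGM (Sum.inl b) f := by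
      simp [doubleAction, canonicalAction]
    rw [this]
    exact Submodule.smul_mem _ _ hb
  | basis p =>
    obtain ⟨s, u⟩ := p
    refine mem_of_forall_normProj h (fun z f hf hz => ?_) hf
    by_cases hu : lact hGM s u = (gPart hGM z⁻¹)⁻¹
    · rw [eq_of_mem_spaceJ (T := xOp k hGM (ract hGM s⁻¹ (gPart hGM z⁻¹)⁻¹)⁻¹) _ hz]
      · exact hX _ _ hf
      · intro x hx
        rw [doubleAction_inl_single, hx, if_pos hu, xOp_single]
    · rw [eq_of_mem_spaceJ (T := 0) _ hz]
      · exact zero_mem _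
      · intro x hx
        rw [doubleAction_inl_single, hx, if_neg hu, LinearMap.zero_apply]

theorem doubleAction_inr_mem (h : ∀ z, ∀ f ∈ N, normProj k hGM z f ∈ N)
    (hX : IsSubrep (xOp k hGM) N) (a : Module.Dual k (Bicross k hGM)) {f : X →₀ k}
    (hf : f ∈ N) : doubleAction k hGM (Sum.inr a) f ∈ N := by
  refine mem_of_forall_normProj h (fun z f hf hz => ?_) hf
  rw [eq_of_mem_spaceJ (T := ∑ w : G, a (basisH k hGM (mPart hGM (w * z * (w : X)⁻¹)⁻¹, w)) •
    xOp k hGM (w : X)⁻¹) _ hz, LinearMap.sum_apply]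
  · exact sum_mem fun w _ => Submodule.smul_mem _ _ (hX _ _ hf)
  · intro x hx
    rw [doubleAction_inr_single, hx, LinearMap.sum_apply]
    simp only [LinearMap.smul_apply, xOp_single]

theorem isSubrep_doubleAction_of (h : ∀ z, ∀ f ∈ N, normProj k hGM z f ∈ N)
    (hX : IsSubrep (xOp k hGM) N) : IsSubrep (doubleAction k hGM) N := by
  rintro (b | a) f hf
  · exact doubleAction_inl_mem h hX b hf
  · exact doubleAction_inr_mem h hX a hf

theorem doubleAction_coord_single (m : M) (u : G) (x : X) :
    doubleAction k hGM (Sum.inr ((basisH k hGM).coord (m, u))) (Finsupp.single x 1) =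
      open Classical in if mPart hGM (u * xNorm hGM x * (u : X)⁻¹)⁻¹ = m then
        Finsupp.single (xAct hGM x (u : X)⁻¹) 1 else 0 := by
  rw [doubleAction_inr_single, Finset.sum_eq_single u]
  · rw [coord_basisH]
    by_cases h : mPart hGM (u * xNorm hGM x * (u : X)⁻¹)⁻¹ = m
    · rw [if_pos h, if_pos (by rw [h]), one_smul]
    · rw [if_neg h, if_neg (fun h' => h (Prod.ext_iff.1 h').1), zero_smul]
  · intro w _ hw
    rw [coord_basisH, if_neg (fun h' => hw (Prod.ext_iff.1 h').2), zero_smul]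
  · exact fun h => absurd (Finset.mem_univ u) h

/-- The functional selects vectors by the `M`-part of the inverse norm and the element of `H` by its
`G`-part. Both use the trivial group element, so nothing is moved, and the two parts together
determine the norm. -/
theorem normProj_eq_doubleAction (z : X) : normProj k hGM z =
    doubleAction k hGM (Sum.inl (basisH k hGM (1, (gPart hGM z⁻¹)⁻¹))) ∘ₗ
      doubleAction k hGM (Sum.inr ((basisH k hGM).coord (mPart hGM z⁻¹, 1))) := by
  refine Finsupp.lhom_ext' fun x => LinearMap.ext_ring ?_
  rw [LinearMap.comp_apply, LinearMap.comp_apply, LinearMap.comp_apply, Finsupp.lsingle_apply,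
    normProj_single, doubleAction_coord_single, Subgroup.coe_one, one_mul, inv_one, mul_one,
    xAct_one]
  by_cases h1 : mPart hGM (xNorm hGM x)⁻¹ = mPart hGM z⁻¹
  · rw [if_pos h1, doubleAction_inl_single, one_lact, inv_one, one_ract]
    by_cases h2 : (gPart hGM z⁻¹)⁻¹ = (gPart hGM (xNorm hGM x)⁻¹)⁻¹
    · rw [if_pos h2, if_pos, Subgroup.coe_one, inv_one, xAct_one]
      rw [inv_inj] at h2
      apply inv_injective
      rw [← gPart_mul_mPart hGM (xNorm hGM x)⁻¹, ← gPart_mul_mPart hGM z⁻¹, h1, h2]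
    · rw [if_neg h2, if_neg fun h => h2 (by rw [h])]
  · rw [if_neg h1, if_neg fun h => h1 (by rw [h]), map_zero]

theorem normProj_mem_of_isSubrep (h : IsSubrep (doubleAction k hGM) N) (z : X) {f : X →₀ k}
    (hf : f ∈ N) : normProj k hGM z f ∈ N := by
  rw [normProj_eq_doubleAction, LinearMap.comp_apply]
  exact h _ _ (h _ _ hf)

theorem xOp_eq_doubleAction_of_mem_left (u : G) {z : X} {f : X →₀ k}
    (hz : f ∈ spaceJ k hGM z) : xOp k hGM u f = doubleAction k hGM (Sum.inr
      ((basisH k hGM).coord (mPart hGM ((u : X)⁻¹ * z * u)⁻¹, u⁻¹))) f := by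
  refine eq_of_mem_spaceJ (fun x hx => ?_) hz
  have hu : mPart hGM ((u⁻¹ : G) * xNorm hGM x * ((u⁻¹ : G) : X)⁻¹)⁻¹ =
      mPart hGM ((u : X)⁻¹ * z * u)⁻¹ := by
    rw [hx, Subgroup.coe_inv, inv_inv]
  rw [xOp_single, doubleAction_coord_single, if_pos hu, Subgroup.coe_inv, inv_inv]

theorem xOp_mem_of_mem_left (h : IsSubrep (doubleAction k hGM) N) (u : G) {f : X →₀ k}
    (hf : f ∈ N) : xOp k hGM u f ∈ N := by
  refine mem_of_forall_normProj (fun z f hf => normProj_mem_of_isSubrep h z hf)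
    (fun z f hf hz => ?_) hf
  rw [xOp_eq_doubleAction_of_mem_left u hz]
  exact h _ f hf

theorem xOp_mem_of_mem_right (h : IsSubrep (doubleAction k hGM) N) (s : M) {f : X →₀ k}
    (hf : f ∈ N) : xOp k hGM s f ∈ N := by
  refine mem_of_forall_normProj (fun z f hf => normProj_mem_of_isSubrep h z hf)
    (fun z f hf hz => ?_) hf
  -- `r` is chosen so that the group element acting on `J_z` is `s`; the index of `δ` is then forced
  -- by the requirement that the operator not vanish on `J_z`.
  obtain ⟨r, hr⟩ : ∃ r : M, ract hGM r (gPart hGM z⁻¹)⁻¹ = s⁻¹ := ⟨_, ract_inv_ract hGM _ _⟩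
  have : xOp k hGM s f = doubleAction k hGM (Sum.inl (basisH k hGM
      (r⁻¹, lact hGM r (gPart hGM z⁻¹)⁻¹))) f := by
    refine eq_of_mem_spaceJ (fun x hx => ?_) hz
    rw [xOp_single, doubleAction_inl_single, hx, inv_inv, hr, Subgroup.coe_inv, inv_inv, if_pos]
    rw [← (mul_act hGM _ _ _).1, inv_mul_cancel, one_lact]
  rw [this]
  exact h _ f hf

theorem isSubrep_xOp_of (h : IsSubrep (doubleAction k hGM) N) : IsSubrep (xOp k hGM) N := by
  intro y f hf
  rw [← gPart_mul_mPart hGM y, xOp_mul]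
  exact xOp_mem_of_mem_right h _ (xOp_mem_of_mem_left h _ hf)

end Crossed
-- The kernel of `sumG` as a stable complement to the kernel of `Π`
section Crossed

variable (k : Type*) [Field k] {X : Type*} [Group X] {G M : Subgroup X}
  (hGM : G.IsComplement' M)

theorem spaceJ_one : spaceJ k hGM 1 = Finsupp.supported k k (G : Set X) := by
  rw [spaceJ]
  congr 1
  ext x
  exact xNorm_eq_one_iff hGM x

open Classical in
/-- The sum of the coefficients of the elements of `G`. -/
noncomputable def sumG (G : Subgroup X) : (X →₀ k) →ₗ[k] k :=
  Finsupp.linearCombination k fun x => if x ∈ G then 1 else 0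

open Classical in
theorem sumG_single (x : X) : sumG k G (Finsupp.single x 1) = if x ∈ G then 1 else 0 := by
  rw [sumG, Finsupp.linearCombination_single, one_smul]

/-- `G` is the set of elements of norm `1`, which conjugation of norms preserves. -/
theorem sumG_xOp (y : X) (f : X →₀ k) : sumG k G (xOp k hGM y f) = sumG k G f := by
  rw [← LinearMap.comp_apply]
  congr 1
  refine Finsupp.lhom_ext' fun x => LinearMap.ext_ring ?_
  have h : xAct hGM x y ∈ G ↔ x ∈ G := by
    rw [← xNorm_eq_one_iff hGM, ← xNorm_eq_one_iff hGM, xNorm_xAct, mul_assoc, inv_mul_eq_one,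
      eq_comm, mul_eq_right]
  by_cases hx : x ∈ G
  · simp [xOp_single, sumG_single, hx, h.2 hx]
  · simp [xOp_single, sumG_single, hx, mt h.1 hx]

theorem sumG_of_mem_spaceJ {z : X} (hz : z ≠ 1) {f : X →₀ k} (hf : f ∈ spaceJ k hGM z) :
    sumG k G f = 0 := by
  refine eq_of_mem_spaceJ (T := 0) (fun x hx => ?_) hf
  rw [sumG_single, if_neg, LinearMap.zero_apply]
  rwa [← xNorm_eq_one_iff hGM, hx]

theorem sumG_normProj_one (f : X →₀ k) : sumG k G (normProj k hGM 1 f) = sumG k G f := by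
  rw [← LinearMap.comp_apply]
  congr 1
  refine Finsupp.lhom_ext' fun x => LinearMap.ext_ring ?_
  by_cases h : xNorm hGM x = 1
  · simp [normProj_single, h]
  · simp [normProj_single, sumG_single, h, ← xNorm_eq_one_iff hGM]

/-- `G` is one orbit for the action of `X`. -/
theorem exists_xAct_eq {u v : X} (hu : u ∈ G) (hv : v ∈ G) : xAct hGM u (u⁻¹ * v) = v := by
  rw [xAct_mem hGM u (mul_mem (inv_mem hu) hv),
    (parts_unique hGM (x := u) (g := ⟨u, hu⟩) (m := 1) (by simp)).1,
    (parts_unique hGM (x := u) (g := ⟨u, hu⟩) (m := 1) (by simp)).2]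
  simp

theorem xAct_injective (y : X) : Function.Injective fun x => xAct hGM x y := by
  intro a b h
  have := congrArg (fun x => xAct hGM x y⁻¹) h
  simpa [← xAct_mul, xAct_one] using this

theorem xOp_apply_xAct (y x : X) (f : X →₀ k) : xOp k hGM y f (xAct hGM x y) = f x :=
  Finsupp.mapDomain_apply (xAct_injective hGM y) f x

variable [Finite X]

attribute [local instance] Fintype.ofFinite

/-- The unit of `H`, as an element of `kX`. -/
noncomputable def unitX (G : Subgroup X) : X →₀ k := ∑ u : G, Finsupp.single (u : X) 1

theorem ident_unitX : ident k hGM (unitX k G) = 1 := by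
  rw [unitX, map_sum, one_def]
  refine Finset.sum_congr rfl fun u _ => ?_
  rw [← ident_single]
  simp

theorem sumG_unitX : sumG k G (unitX k G) = Fintype.card G := by
  simp [unitX, sumG_single]

theorem mapPi_doubleAction (i : Bicross k hGM ⊕ Module.Dual k (Bicross k hGM)) (f : X →₀ k) :
    mapPi k hGM (doubleAction k hGM i f) = plusAction k (Bicross k hGM) i (mapPi k hGM f) := by
  have h := projPlus_canonicalAction i (ident k hGM f)
  rw [mapPi, doubleAction, LinearMap.comp_apply, LinearMap.comp_apply, LinearMap.comp_apply,
    LinearMap.comp_apply, LinearEquiv.coe_coe, LinearEquiv.coe_coe, LinearEquiv.apply_symm_apply]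
  exact h

theorem coe_mapPi (f : X →₀ k) : (mapPi k hGM f : Bicross k hGM) =
    ident k hGM f - Coalgebra.counit (R := k) (ident k hGM f) • (1 : Bicross k hGM) := by
  simp [mapPi, projPlus]

theorem mapPi_unitX : mapPi k hGM (unitX k G) = 0 := by
  apply Subtype.ext
  rw [coe_mapPi, ident_unitX]
  simp

theorem exists_of_mapPi_eq_zero {f : X →₀ k} (hf : mapPi k hGM f = 0) :
    ∃ c : k, f = c • unitX k G := by
  refine ⟨Coalgebra.counit (R := k) (ident k hGM f), (ident k hGM).injective ?_⟩
  rw [map_smul, ident_unitX, ← sub_eq_zero, ← coe_mapPi, hf, Submodule.coe_zero]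

theorem isSubrep_ker_sumG : IsSubrep (doubleAction k hGM) (LinearMap.ker (sumG k G)) := by
  refine isSubrep_doubleAction_of (fun z f hf => ?_) (fun y f hf => ?_)
  · by_cases hz : z = 1
    · rw [hz, LinearMap.mem_ker, sumG_normProj_one]
      exact hf
    · exact sumG_of_mem_spaceJ k hGM hz (normProj_mem k hGM z f)
  · rw [LinearMap.mem_ker, sumG_xOp]
    exact hf

variable [CharZero k]

/-- The kernel of `Π` is spanned by `unitX`, on which `sumG` is `|G|`; characteristic zero makes
this nonzero. -/
theorem mapPi_injOn : Set.InjOn (mapPi k hGM) (LinearMap.ker (sumG k G)) := by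
  intro f hf g hg h
  rw [← sub_eq_zero, ← map_sub] at h
  obtain ⟨c, hc⟩ := exists_of_mapPi_eq_zero k hGM h
  have h0 : sumG k G (f - g) = 0 := LinearMap.mem_ker.1 (sub_mem hf hg)
  rw [hc, map_smul, sumG_unitX, smul_eq_mul, mul_eq_zero] at h0
  rcases h0 with h0 | h0
  · rw [h0, zero_smul] at hc
    exact sub_eq_zero.1 hc
  · exact absurd h0 (Nat.cast_ne_zero.2 Fintype.card_ne_zero)

theorem exists_mapPi_eq (w : Aug k (Bicross k hGM)) :
    ∃ f ∈ LinearMap.ker (sumG k G), mapPi k hGM f = w := by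
  let g := (ident k hGM).symm w
  have hG : (Fintype.card G : k) ≠ 0 := Nat.cast_ne_zero.2 Fintype.card_ne_zero
  -- Subtracting a multiple of `unitX` makes `sumG` vanish and is invisible to `Π`.
  refine ⟨g - (sumG k G g / Fintype.card G) • unitX k G, ?_, ?_⟩
  · rw [LinearMap.mem_ker, map_sub, map_smul, sumG_unitX, smul_eq_mul, div_mul_cancel₀ _ hG,
      sub_self]
  · rw [map_sub, map_smul, mapPi_unitX, smul_zero, sub_zero]
    apply Subtype.ext
    rw [coe_mapPi]
    simp only [g, LinearEquiv.apply_symm_apply]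
    rw [LinearMap.mem_ker.1 w.2, zero_smul, sub_zero]

/-- Only the multiples of `unitX` are fixed by `X` in `kG`, and they do not lie in the kernel of
`sumG`. -/
theorem isNontrivialRep_of_le {N : Submodule k (X →₀ k)} (hN : N ≠ ⊥)
    (hK : N ≤ LinearMap.ker (sumG k G)) (hJ : N ≤ Finsupp.supported k k (G : Set X)) :
    IsNontrivialRep k hGM N := by
  by_contra h
  simp only [IsNontrivialRep, not_exists, not_and, not_not] at h
  refine hN ((Submodule.eq_bot_iff N).2 fun f hf => ?_)
  have hc : f = f 1 • unitX k G := by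
    ext x
    by_cases hx : x ∈ G
    · have h1 := xOp_apply_xAct k hGM (1⁻¹ * x) 1 f
      rw [exists_xAct_eq hGM (one_mem G) hx, h _ f hf] at h1
      rw [h1, Finsupp.smul_apply, unitX, Finsupp.finsetSum_apply,
        Finset.sum_eq_single ⟨x, hx⟩]
      · simp
      · intro b _ hb
        exact Finsupp.single_eq_of_ne fun h => hb (Subtype.ext h.symm)
      · simp
    · have h1 : f x = 0 := (Finsupp.mem_supported' k f).1 (hJ hf) x hx
      rw [h1, Finsupp.smul_apply, unitX, Finsupp.finsetSum_apply, Finset.sum_eq_zero, smul_zero]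
      intro b _
      exact Finsupp.single_eq_of_ne fun h => hx (h ▸ b.2)
  have h0 := LinearMap.mem_ker.1 (hK hf)
  rw [hc, map_smul, sumG_unitX, smul_eq_mul, mul_eq_zero] at h0
  rcases h0 with h0 | h0
  · rw [hc, h0, zero_smul]
  · exact absurd h0 (Nat.cast_ne_zero.2 Fintype.card_ne_zero)

omit [Finite X] [CharZero k] in
-- Every difference `f y - f` lies in `ker sumG`, so a nontrivial module meets that kernel, and
-- irreducibility puts it inside.
theorem le_ker_sumG_of_isNontrivialRep {N : Submodule k (X →₀ k)}
    (hN : IsIrreducibleSubrep (xOp k hGM) N) (h : IsNontrivialRep k hGM N) :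
    N ≤ LinearMap.ker (sumG k G) := by
  have hs : IsSubrep (xOp k hGM) (N ⊓ LinearMap.ker (sumG k G)) := fun y f hf =>
    ⟨hN.2.1 y f hf.1, by rw [SetLike.mem_coe, LinearMap.mem_ker, sumG_xOp]; exact hf.2⟩
  rcases hN.2.2 _ inf_le_left hs with h0 | h0
  · obtain ⟨y, f, hf, hne⟩ := h
    refine absurd ?_ hne
    rw [← sub_eq_zero, ← Submodule.mem_bot k, ← h0]
    refine ⟨sub_mem (hN.2.1 y f hf) hf, ?_⟩
    rw [SetLike.mem_coe, LinearMap.mem_ker, map_sub, sumG_xOp, sub_self]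
  · exact inf_eq_left.1 h0

end Crossed
-- Induction from centralizers and the classification
section Crossed

variable {k : Type*} [Field k] {X : Type*} [Group X] {G M : Subgroup X}
  {hGM : G.IsComplement' M} {z₀ : X} {bar : conjugatesOf z₀ → X} {M₀ : Submodule k (X →₀ k)}

theorem mem_centralizer_iff_conj (z y : X) :
    y ∈ Subgroup.centralizer ({z} : Set X) ↔ y⁻¹ * z * y = z := by
  rw [Subgroup.mem_centralizer_singleton_iff, mul_assoc, inv_mul_eq_iff_eq_mul, eq_comm]

theorem conj_mem_conjugatesOf (z₀ y : X) : y⁻¹ * z₀ * y ∈ conjugatesOf z₀ := by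
  exact isConj_iff.2 ⟨y⁻¹, by simp⟩

theorem exists_isConjChoice (z₀ : X) : ∃ bar : conjugatesOf z₀ → X, IsConjChoice z₀ bar := by
  have h : ∀ z : conjugatesOf z₀, ∃ y : X, (z : X) = y⁻¹ * z₀ * y := fun z => by
    obtain ⟨c, hc⟩ := isConj_iff.1 z.2
    exact ⟨c⁻¹, by rw [← hc, inv_inv]⟩
  choose bar hbar using h
  exact ⟨bar, hbar⟩

theorem translate_le_spaceJ (hJ : M₀ ≤ spaceJ k hGM z₀) (hbar : IsConjChoice z₀ bar)
    (z : conjugatesOf z₀) : translate k hGM z₀ bar M₀ z ≤ spaceJ k hGM z := by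
  rintro _ ⟨f, hf, rfl⟩
  rw [hbar z]
  exact xOp_mem_spaceJ k hGM _ (hJ hf)

theorem iSupIndep_translate (hJ : M₀ ≤ spaceJ k hGM z₀) (hbar : IsConjChoice z₀ bar) :
    iSupIndep (translate k hGM z₀ bar M₀) := by
  intro z
  rw [Submodule.disjoint_def]
  intro f hf hf'
  have h : ⨆ w, ⨆ _ : w ≠ z, translate k hGM z₀ bar M₀ w ≤
      LinearMap.ker (normProj k hGM (z : X)) :=
    iSup₂_le fun w hw g hg => normProj_of_mem_ne k hGM (fun h => hw (Subtype.ext h))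
      (translate_le_spaceJ hJ hbar w hg)
  rw [← normProj_of_mem k hGM (translate_le_spaceJ hJ hbar z hf)]
  exact h hf'

theorem xOp_mem_of_conj_eq (hs : IsSubrep (centralizerOp k hGM z₀) M₀) {y : X}
    (hy : y⁻¹ * z₀ * y = z₀) {f : X →₀ k} (hf : f ∈ M₀) : xOp k hGM y f ∈ M₀ :=
  hs ⟨y, (mem_centralizer_iff_conj z₀ y).2 hy⟩ f hf

/-- `y` differs from the chosen representative of `y⁻¹ z₀ y` by a left factor centralizing `z₀`.
Hence the sum is `X`-stable whatever the choice. -/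
theorem xOp_mem_sumTranslates (hs : IsSubrep (centralizerOp k hGM z₀) M₀)
    (hbar : IsConjChoice z₀ bar) (y : X) {f : X →₀ k} (hf : f ∈ M₀) :
    xOp k hGM y f ∈ sumTranslates k hGM z₀ bar M₀ := by
  let z : conjugatesOf z₀ := ⟨y⁻¹ * z₀ * y, conj_mem_conjugatesOf z₀ y⟩
  have hz : y⁻¹ * z₀ * y = (bar z)⁻¹ * z₀ * bar z := hbar z
  refine Submodule.mem_iSup_of_mem z ⟨xOp k hGM (y * (bar z)⁻¹) f, ?_, ?_⟩
  · refine xOp_mem_of_conj_eq hs ?_ hf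
    calc (y * (bar z)⁻¹)⁻¹ * z₀ * (y * (bar z)⁻¹)
        = bar z * (y⁻¹ * z₀ * y) * (bar z)⁻¹ := by group
      _ = z₀ := by rw [hz]; group
  · rw [← xOp_mul, inv_mul_cancel_right]

theorem sumTranslates_le_comap {W : Type*} [AddCommGroup W] [Module k W]
    {T : (X →₀ k) →ₗ[k] W} {P : Submodule k W}
    (h : ∀ z, ∀ f ∈ M₀, T (xOp k hGM (bar z) f) ∈ P) :
    sumTranslates k hGM z₀ bar M₀ ≤ P.comap T := by
  refine iSup_le fun z => ?_
  rintro _ ⟨f, hf, rfl⟩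
  exact h z f hf

theorem le_sumTranslates (hs : IsSubrep (centralizerOp k hGM z₀) M₀)
    (hbar : IsConjChoice z₀ bar) : M₀ ≤ sumTranslates k hGM z₀ bar M₀ := fun f hf => by
  have := xOp_mem_sumTranslates hs hbar 1 hf
  rwa [xOp_one] at this

theorem xOp_bar_mem_spaceJ (hJ : M₀ ≤ spaceJ k hGM z₀) (hbar : IsConjChoice z₀ bar)
    (z : conjugatesOf z₀) {f : X →₀ k} (hf : f ∈ M₀) :
    xOp k hGM (bar z) f ∈ spaceJ k hGM z :=
  translate_le_spaceJ hJ hbar z ⟨f, hf, rfl⟩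

/-- Projecting to `J_{z₀}` kills every translate except the one at `z₀`, whose representative
centralizes `z₀`. -/
theorem sumTranslates_inf_spaceJ_le (hs : IsSubrep (centralizerOp k hGM z₀) M₀)
    (hJ : M₀ ≤ spaceJ k hGM z₀) (hbar : IsConjChoice z₀ bar) :
    sumTranslates k hGM z₀ bar M₀ ⊓ spaceJ k hGM z₀ ≤ M₀ := by
  rintro f ⟨hf, hf'⟩
  rw [← normProj_of_mem k hGM hf']
  refine sumTranslates_le_comap (T := normProj k hGM z₀) (fun z g hg => ?_) hf
  have hz := xOp_bar_mem_spaceJ hJ hbar z hg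
  by_cases h : (z : X) = z₀
  · rw [normProj_of_mem k hGM (h ▸ hz)]
    exact xOp_mem_of_conj_eq hs (by rw [← hbar z, h]) hg
  · rw [normProj_of_mem_ne k hGM h hz]
    exact zero_mem _

theorem sumTranslates_le_ker_sumG (hJ : M₀ ≤ spaceJ k hGM z₀) (hbar : IsConjChoice z₀ bar)
    (hz₀ : z₀ ≠ 1) : sumTranslates k hGM z₀ bar M₀ ≤ LinearMap.ker (sumG k G) := by
  refine iSup_le fun z f hf => sumG_of_mem_spaceJ k hGM (fun h => hz₀ ?_)
    (translate_le_spaceJ hJ hbar z hf)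
  have := hbar z
  rw [h, eq_comm, mul_assoc, inv_mul_eq_one, eq_comm, mul_eq_right] at this
  exact this

theorem sumTranslates_one {bar : conjugatesOf (1 : X) → X} (hs : IsSubrep (xOp k hGM) M₀) :
    sumTranslates k hGM 1 bar M₀ = M₀ := by
  refine le_antisymm (sumTranslates_le_comap (T := LinearMap.id) fun z f hf => hs _ f hf)
    fun f hf => ?_
  exact Submodule.mem_iSup_of_mem ⟨1, mem_conjugatesOf_self⟩
    ⟨_, hs _ f hf, xOp_xOp_inv k hGM _ f⟩

theorem mem_imageZ_of_spaceJ_ne_bot {z : X} {N : Submodule k (X →₀ k)}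
    (h : N ⊓ spaceJ k hGM z ≠ ⊥) : z ∈ imageZ hGM := by
  by_contra hz
  refine h (le_bot_iff.1 (inf_le_right.trans ?_))
  rw [spaceJ, Set.eq_empty_of_forall_notMem (s := xNorm hGM ⁻¹' {z}) fun x hx => hz ⟨x, hx⟩,
    Finsupp.supported_empty]

variable [Finite X]

theorem isSubrep_sumTranslates (hs : IsSubrep (centralizerOp k hGM z₀) M₀)
    (hJ : M₀ ≤ spaceJ k hGM z₀) (hbar : IsConjChoice z₀ bar) :
    IsSubrep (doubleAction k hGM) (sumTranslates k hGM z₀ bar M₀) := by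
  refine isSubrep_doubleAction_of (fun w f hf => ?_) (fun y f hf => ?_)
  · refine sumTranslates_le_comap (T := normProj k hGM w)
      (P := sumTranslates k hGM z₀ bar M₀) (fun z g hg => ?_) hf
    have hz := xOp_bar_mem_spaceJ hJ hbar z hg
    by_cases h : (z : X) = w
    · rw [normProj_of_mem k hGM (h ▸ hz)]
      exact xOp_mem_sumTranslates hs hbar _ hg
    · rw [normProj_of_mem_ne k hGM h hz]
      exact zero_mem _
  · refine sumTranslates_le_comap (T := xOp k hGM y)
      (P := sumTranslates k hGM z₀ bar M₀) (fun z g hg => ?_) hf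
    rw [← xOp_mul]
    exact xOp_mem_sumTranslates hs hbar _ hg

theorem isSubrep_inf_spaceJ {N : Submodule k (X →₀ k)} (hN : IsSubrep (doubleAction k hGM) N)
    (z₀ : X) : IsSubrep (centralizerOp k hGM z₀) (N ⊓ spaceJ k hGM z₀) := by
  rintro ⟨y, hy⟩ f hf
  refine ⟨isSubrep_xOp_of hN y f hf.1, ?_⟩
  have := xOp_mem_spaceJ k hGM y hf.2
  rwa [(mem_centralizer_iff_conj z₀ y).1 hy] at this

theorem sumTranslates_le {N : Submodule k (X →₀ k)} (hN : IsSubrep (doubleAction k hGM) N)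
    (h : M₀ ≤ N) : sumTranslates k hGM z₀ bar M₀ ≤ N :=
  sumTranslates_le_comap (T := LinearMap.id) fun _ f hf => isSubrep_xOp_of hN _ f (h hf)

attribute [local instance] Fintype.ofFinite in
theorem exists_inf_spaceJ_ne_bot {N : Submodule k (X →₀ k)}
    (hN : IsSubrep (doubleAction k hGM) N) (hne : N ≠ ⊥) : ∃ z, N ⊓ spaceJ k hGM z ≠ ⊥ := by
  by_contra! h
  refine hne ((Submodule.eq_bot_iff N).2 fun f hf => ?_)
  rw [← sum_normProj k hGM f]
  refine Finset.sum_eq_zero fun z _ => ?_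
  rw [← Submodule.mem_bot k, ← h z]
  exact ⟨normProj_mem_of_isSubrep hN z hf, normProj_mem k hGM z f⟩

theorem isIrreducibleSubrep_sumTranslates (hM : IsIrreducibleSubrep (centralizerOp k hGM z₀) M₀)
    (hJ : M₀ ≤ spaceJ k hGM z₀) (hbar : IsConjChoice z₀ bar) :
    IsIrreducibleSubrep (doubleAction k hGM) (sumTranslates k hGM z₀ bar M₀) := by
  refine ⟨fun h => hM.1 (le_bot_iff.1 (h ▸ le_sumTranslates hM.2.1 hbar)),
    isSubrep_sumTranslates hM.2.1 hJ hbar, fun N hle hN => ?_⟩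
  by_cases hne : N = ⊥
  · exact Or.inl hne
  right
  have hle' : N ⊓ spaceJ k hGM z₀ ≤ M₀ :=
    (inf_le_inf_right _ hle).trans (sumTranslates_inf_spaceJ_le hM.2.1 hJ hbar)
  rcases hM.2.2 _ hle' (isSubrep_inf_spaceJ hN z₀) with h | h
  -- If the `z₀`-component of `N` vanishes, so does every other: conjugates of `z₀` are carried back
  -- to it by `X`, and the sum of translates has no components elsewhere.
  · obtain ⟨z, hz⟩ := exists_inf_spaceJ_ne_bot hN hne
    refine absurd ((Submodule.eq_bot_iff _).2 fun f hf => ?_) hz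
    rw [← normProj_of_mem k hGM hf.2]
    by_cases hc : ∃ y : X, z = y⁻¹ * z₀ * y
    · obtain ⟨y, rfl⟩ := hc
      have h0 : xOp k hGM y⁻¹ f ∈ N ⊓ spaceJ k hGM z₀ := by
        refine ⟨isSubrep_xOp_of hN _ f hf.1, ?_⟩
        have := xOp_mem_spaceJ k hGM y⁻¹ hf.2
        rwa [show y⁻¹⁻¹ * (y⁻¹ * z₀ * y) * y⁻¹ = z₀ by group] at this
      rw [h, Submodule.mem_bot] at h0
      rw [normProj_of_mem k hGM hf.2, ← xOp_xOp_inv k hGM y f, h0, map_zero]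
    · rw [← Submodule.mem_bot k]
      refine sumTranslates_le_comap (T := normProj k hGM z) (P := ⊥) (fun w g hg => ?_) (hle hf.1)
      rw [Submodule.mem_bot]
      exact normProj_of_mem_ne k hGM (fun h => hc ⟨bar w, by rw [← h, hbar w]⟩)
        (xOp_bar_mem_spaceJ hJ hbar w hg)
  · exact le_antisymm hle (sumTranslates_le hN (inf_eq_right.1 (by rw [← h]; simp)))

theorem isSubrep_doubleAction_of_le_spaceJ_one (hJ : M₀ ≤ spaceJ k hGM 1)
    (hs : IsSubrep (xOp k hGM) M₀) : IsSubrep (doubleAction k hGM) M₀ := by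
  refine isSubrep_doubleAction_of (fun z f hf => ?_) hs
  by_cases h : 1 = z
  · rw [normProj_of_mem k hGM (h ▸ hJ hf)]
    exact hf
  · rw [normProj_of_mem_ne k hGM h (hJ hf)]
    exact zero_mem _

/-- Inside `J_e` the grading condition is vacuous, so `D(H)`-stability is just `X`-stability. -/
theorem isIrreducibleSubrep_doubleAction_iff (hJ : M₀ ≤ spaceJ k hGM 1) :
    IsIrreducibleSubrep (doubleAction k hGM) M₀ ↔ IsIrreducibleSubrep (xOp k hGM) M₀ :=
  ⟨fun h => ⟨h.1, isSubrep_xOp_of h.2.1, fun N hle hN =>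
    h.2.2 N hle (isSubrep_doubleAction_of_le_spaceJ_one (hle.trans hJ) hN)⟩,
  fun h => ⟨h.1, isSubrep_doubleAction_of_le_spaceJ_one hJ h.2.1, fun N hle hN =>
    h.2.2 N hle (isSubrep_xOp_of hN)⟩⟩

variable {N : Submodule k (X →₀ k)}

theorem eq_sumTranslates (hN : IsIrreducibleSubrep (doubleAction k hGM) N)
    (hs : IsSubrep (centralizerOp k hGM z₀) M₀) (hJ : M₀ ≤ spaceJ k hGM z₀) (hle : M₀ ≤ N)
    (hne : M₀ ≠ ⊥) (hbar : IsConjChoice z₀ bar) : sumTranslates k hGM z₀ bar M₀ = N := by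
  refine (hN.2.2 _ (sumTranslates_le hN.2.1 hle)
    (isSubrep_sumTranslates hs hJ hbar)).resolve_left fun h => hne (le_bot_iff.1 ?_)
  exact h ▸ le_sumTranslates hs hbar

/-- A nonzero centralizer submodule of the component generates `N` by translation, while the
`z₀`-component of what it generates lies in that submodule. -/
theorem isIrreducibleSubrep_inf_spaceJ (hN : IsIrreducibleSubrep (doubleAction k hGM) N)
    (hne : N ⊓ spaceJ k hGM z₀ ≠ ⊥) :
    IsIrreducibleSubrep (centralizerOp k hGM z₀) (N ⊓ spaceJ k hGM z₀) := by
  refine ⟨hne, isSubrep_inf_spaceJ hN.2.1 z₀, fun M' hle hs => ?_⟩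
  by_cases h : M' = ⊥
  · exact Or.inl h
  obtain ⟨bar, hbar⟩ := exists_isConjChoice z₀
  have hJ := hle.trans inf_le_right
  refine Or.inr (le_antisymm hle ?_)
  rw [← eq_sumTranslates hN hs hJ (hle.trans inf_le_left) h hbar]
  exact sumTranslates_inf_spaceJ_le hs hJ hbar

/-- Conjugation fixes `e`, so `N ⊓ J_e` is itself a `D(H)`-submodule. -/
theorem le_spaceJ_one (hN : IsIrreducibleSubrep (doubleAction k hGM) N)
    (hne : N ⊓ spaceJ k hGM 1 ≠ ⊥) : N ≤ spaceJ k hGM 1 := by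
  have hs : IsSubrep (xOp k hGM) (N ⊓ spaceJ k hGM 1) := fun y f hf =>
    ⟨isSubrep_xOp_of hN.2.1 y f hf.1, by simpa using xOp_mem_spaceJ k hGM y hf.2⟩
  exact inf_eq_left.1 ((hN.2.2 _ inf_le_left
    (isSubrep_doubleAction_of_le_spaceJ_one inf_le_right hs)).resolve_left hne)

variable [CharZero k]

theorem isIrreducibleQuantumTangentSpace_map (hN : IsIrreducibleSubrep (doubleAction k hGM) N)
    (hK : N ≤ LinearMap.ker (sumG k G)) :
    IsIrreducibleQuantumTangentSpace k (Bicross k hGM) (N.map (mapPi k hGM)) ∧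
      RestrictsToIso (doubleAction k hGM) (plusAction k (Bicross k hGM)) (mapPi k hGM)
        N (N.map (mapPi k hGM)) :=
  have hinj := (mapPi_injOn k hGM).mono hK
  ⟨isIrreducibleSubrep_map (mapPi_doubleAction k hGM) hinj hN, rfl, hinj,
    fun i f _ => mapPi_doubleAction k hGM i f⟩

/-- The full preimage of `L` contains the kernel of `Π`; its part in `ker sumG` is the lift
isomorphic to `L`. -/
theorem exists_isIrreducibleSubrep_map_eq {L : Submodule k (Aug k (Bicross k hGM))}
    (hL : IsIrreducibleQuantumTangentSpace k (Bicross k hGM) L) :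
    ∃ N : Submodule k (X →₀ k), IsIrreducibleSubrep (doubleAction k hGM) N ∧
      N ≤ LinearMap.ker (sumG k G) ∧ N.map (mapPi k hGM) = L := by
  have hm : (LinearMap.ker (sumG k G) ⊓ L.comap (mapPi k hGM)).map (mapPi k hGM) = L := by
    refine le_antisymm (by rintro _ ⟨f, hf, rfl⟩; exact hf.2) fun w hw => ?_
    obtain ⟨f, hf, rfl⟩ := exists_mapPi_eq k hGM w
    exact ⟨f, ⟨hf, hw⟩, rfl⟩
  refine ⟨_, ?_, inf_le_left, hm⟩
  refine isIrreducibleSubrep_of_map (mapPi_doubleAction k hGM)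
    ((mapPi_injOn k hGM).mono inf_le_left)
    ((isSubrep_ker_sumG k hGM).inf (hL.2.1.comap (mapPi_doubleAction k hGM))) ?_
  rw [hm]
  exact hL

end Crossed
end QTangent

open QTangent

theorem mainTheorem2 {k : Type*} [Field k] [CharZero k] {X : Type*} [Group X] [Finite X]
    (G M : Subgroup X) (hGM : G.IsComplement' M) :
    -- (a) conjugacy classes other than `{e}`
    (∀ z₀ ∈ imageZ hGM, z₀ ≠ 1 →
      ∀ M₀ : Submodule k (X →₀ k), M₀ ≤ spaceJ k hGM z₀ →
        IsIrreducibleSubrep (centralizerOp k hGM z₀) M₀ →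
      ∀ bar : conjugatesOf z₀ → X, IsConjChoice z₀ bar →
        iSupIndep (translate k hGM z₀ bar M₀) ∧
        IsIrreducibleSubrep (doubleAction k hGM) (sumTranslates k hGM z₀ bar M₀) ∧
        IsIrreducibleQuantumTangentSpace k (Bicross k hGM)
          ((sumTranslates k hGM z₀ bar M₀).map (mapPi k hGM)) ∧
        RestrictsToIso (doubleAction k hGM) (plusAction k (Bicross k hGM)) (mapPi k hGM)
          (sumTranslates k hGM z₀ bar M₀)
          ((sumTranslates k hGM z₀ bar M₀).map (mapPi k hGM))) ∧
    -- (b) the conjugacy class `{e}`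
    ((1 : X) ∈ imageZ hGM ∧ conjugatesOf (1 : X) = {1} ∧
      spaceJ k hGM 1 = Finsupp.supported k k (G : Set X) ∧
      Subgroup.centralizer ({1} : Set X) = ⊤ ∧
      ∀ M₀ : Submodule k (X →₀ k), M₀ ≤ Finsupp.supported k k (G : Set X) →
        IsIrreducibleSubrep (xOp k hGM) M₀ → IsNontrivialRep k hGM M₀ →
        (∀ bar : conjugatesOf (1 : X) → X, sumTranslates k hGM 1 bar M₀ = M₀) ∧
        IsIrreducibleSubrep (doubleAction k hGM) M₀ ∧
        IsIrreducibleQuantumTangentSpace k (Bicross k hGM) (M₀.map (mapPi k hGM)) ∧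
        RestrictsToIso (doubleAction k hGM) (plusAction k (Bicross k hGM)) (mapPi k hGM)
          M₀ (M₀.map (mapPi k hGM))) ∧
    -- every irreducible quantum tangent space arises in this way
    (∀ L : Submodule k (Aug k (Bicross k hGM)),
      IsIrreducibleQuantumTangentSpace k (Bicross k hGM) L →
        (∃ z₀ ∈ imageZ hGM, z₀ ≠ 1 ∧
          ∃ M₀ : Submodule k (X →₀ k), M₀ ≤ spaceJ k hGM z₀ ∧
            IsIrreducibleSubrep (centralizerOp k hGM z₀) M₀ ∧
            ∀ bar : conjugatesOf z₀ → X, IsConjChoice z₀ bar →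
              L = (sumTranslates k hGM z₀ bar M₀).map (mapPi k hGM)) ∨
        (∃ M₀ : Submodule k (X →₀ k), M₀ ≤ Finsupp.supported k k (G : Set X) ∧
          IsIrreducibleSubrep (xOp k hGM) M₀ ∧ IsNontrivialRep k hGM M₀ ∧
          L = M₀.map (mapPi k hGM))) := by
  refine ⟨fun z₀ _ hz₀ M₀ hJ hM bar hbar => ?_, ⟨?_, ?_, ?_, ?_, fun M₀ hG hM hnt => ?_⟩,
    fun L hL => ?_⟩
  · have hN := isIrreducibleSubrep_sumTranslates hM hJ hbar
    exact ⟨iSupIndep_translate hJ hbar, hN, isIrreducibleQuantumTangentSpace_map hN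
      (sumTranslates_le_ker_sumG hJ hbar hz₀)⟩
  · exact ⟨1, (xNorm_eq_one_iff hGM 1).2 (one_mem G)⟩
  · ext z
    exact isConj_one_right
  · exact spaceJ_one k hGM
  · ext y
    simp [mem_centralizer_iff_conj]
  · have hN := (isIrreducibleSubrep_doubleAction_iff (hG.trans (spaceJ_one k hGM).ge)).2 hM
    exact ⟨fun bar => sumTranslates_one hM.2.1, hN, isIrreducibleQuantumTangentSpace_map hN
      (le_ker_sumG_of_isNontrivialRep k hGM hM hnt)⟩
  · obtain ⟨N, hN, hK, rfl⟩ := exists_isIrreducibleSubrep_map_eq hL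
    -- Any `z₀` with nonzero component will do: the case split depends on whether it is `e`.
    obtain ⟨z₀, hne⟩ := exists_inf_spaceJ_ne_bot hN.2.1 hN.1
    by_cases hz₀ : z₀ = 1
    · right
      subst hz₀
      have hJ := le_spaceJ_one hN hne
      have hG := hJ.trans (spaceJ_one k hGM).le
      exact ⟨N, hG, (isIrreducibleSubrep_doubleAction_iff hJ).1 hN,
        isNontrivialRep_of_le k hGM hN.1 hK hG, rfl⟩
    · left
      have hM := isIrreducibleSubrep_inf_spaceJ hN hne
      refine ⟨z₀, mem_imageZ_of_spaceJ_ne_bot hne, hz₀, _, inf_le_right, hM, fun bar hbar => ?_⟩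
      rw [eq_sumTranslates hN hM.2.1 inf_le_right inf_le_left hne hbar]
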